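/- **Theorem (amortized lower bound for approximate counters).** Consider asynchronous deterministic shared-memory implementations of a counter by $n$ processes. A *primitive* of arity $a$ is given by an update function $g$ and a response function $h$: applied with input $w$ to a vector of $a$ distinct base objects holding the values $\vec v$, it atomically replaces these values by $g(\vec v,w)$ and returns $h(\vec v,w)$. It is *conditional* if for every input $w$ there is at most one vector $\vec v$ with $g(\vec v,w)\neq\vec v$ (the response function $h$ is arbitrary). A *$k$-multiplicative-accurate counter* ($k>0$ real) is a linearizable object with operations CounterIncrement and CounterRead, in whose sequential specification a CounterRead that is preceded by $v$ CounterIncrements returns a value $x$ with $v/k\le x\le v\cdot k$. An implementation is *solo-terminating* if, after every execution, each process with a pending operation completes it if it runs alone for sufficiently many steps. An *event* (or *step*) is the application of a primitive by a process. The *amortized step complexity* of an implementation is the supremum, over all finite executions in which at least one operation is invoked, of the total number of steps performed by the invoked operations divided by the number of invoked operations. There is an absolute constant $c>0$ such that the following holds for all $n$, all integers $q\ge 1$, all real $k$ with $0<k\le\sqrt{n/2}$, and every $n$-process solo-terminating implementation $A$ of a $k$-multiplicative-accurate counter from base objects that support only reads, writes, and conditional primitives of arity at most $q$: 1. $A$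 has a finite execution containing at least $c\,n\log_{q+1}(n/k^2)$ events, in which every process performs exactly one CounterIncrement followed by exactly one CounterRead, and all these operations are completed; 2. the amortized step complexity of $A$ is at least $c\,\log_{q+1}(n/k^2)$. -/

import Mathlib

universe u

noncomputable section

namespace SharedCounter

/-- The two operations of a counter. -/
inductive CounterOp
  | increment
  | read

/-- A read-modify-write primitive over the domain `D`: when it is applied with input `w` to a vector
of `arity` base objects holding the values `v`, these values are atomically replaced by
`update v w`, and `response v w` is returned to the process. -/
structure Primitive (D : Type u) where
  arity : ℕ
  Input : Type u
  Response : Type u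
  update : (Fin arity → D) → Input → (Fin arity → D)
  response : (Fin arity → D) → Input → Response

/-- A read: applied to a single base object, which it leaves unchanged. -/
def Primitive.IsRead {D : Type u} (P : Primitive D) : Prop :=
  P.arity = 1 ∧ ∀ v w, P.update v w = v

/-- A write: applied to a single base object; it installs a value determined by the input, and its
response carries no information on the value that is overwritten. -/
def Primitive.IsWrite {D : Type u} (P : Primitive D) : Prop :=
  P.arity = 1 ∧ ∀ w, ∃ (d : D) (r : P.Response), ∀ v, P.update v w = (fun _ => d) ∧ P.response v w = r

/-- A conditional primitive: for every input there is at most one change point. The response function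
is arbitrary. -/
def Primitive.IsConditional {D : Type u} (P : Primitive D) : Prop :=
  ∀ w, {v | P.update v w ≠ v}.encard ≤ 1

/-- What a process with a pending operation does next: either it ends the operation, with
response `x`, moving to the local state `s` (for an increment the response is a mere
acknowledgement, and the number `x` has no meaning), or it applies the primitive `P` with input `w`
to a vector of distinct base objects and moves to a local state that depends on the response. -/
inductive Action (Obj Val State : Type u) : Type (u + 1)
  | respond (x : ℝ) (s : State)
  | apply (P : Primitive.{u} Val) (w : P.Input) (objs : Fin P.arity ↪ Obj)
      (cont : P.Response → State)

/-- A deterministic algorithm by which `n` processes apply counter operations, using a (possibly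
infinite) collection `Obj` of base objects. Local states persist between the operations of a
process. -/
structure Implementation (n : ℕ) where
  Obj : Type u
  Val : Type u
  State : Type u
  initVal : Obj → Val
  initState : Fin n → State
  /-- the local state of a process after it invokes an operation -/
  invoke : Fin n → CounterOp → State → State
  /-- the next action of a process that has a pending operation -/
  next : Fin n → State → Action Obj Val State

/-- The events of an execution. `step p` is the application of a primitive by the process `p`;
`invoke` and `respond` mark the beginning and the end of an operation. -/
inductive Event (n : ℕ)
  | invoke (p : Fin n) (op : CounterOp)
  | step (p : Fin n)
  | respond (p : Fin n) (x : ℝ)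

namespace Implementation

variable {n : ℕ}

/-- A configuration: the values of the base objects, the local states of the processes, and for each
process its pending operation, if there is one. -/
structure Config (A : Implementation.{u} n) where
  mem : A.Obj → A.Val
  loc : Fin n → A.State
  pending : Fin n → Option CounterOp

def init (A : Implementation.{u} n) : A.Config where
  mem := A.initVal
  loc := A.initState
  pending := fun _ => none

/-- No process has a pending operation. -/
def Config.Quiescent {A : Implementation.{u} n} (C : A.Config) : Prop :=
  ∀ p, C.pending p = none

/-- `A.Step C e C'`: the event `e` is possible in `C` and leads to `C'`. -/
inductive Step (A : Implementation.{u} n) : A.Config → Event n → A.Config → Prop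
  | invoke (C : A.Config) (p : Fin n) (op : CounterOp) (hp : C.pending p = none) :
      Step A C (.invoke p op)
        { mem := C.mem
          loc := Function.update C.loc p (A.invoke p op (C.loc p))
          pending := Function.update C.pending p (some op) }
  | step (C : A.Config) (p : Fin n) (P : Primitive.{u} A.Val) (w : P.Input)
      (objs : Fin P.arity ↪ A.Obj) (cont : P.Response → A.State)
      (hp : C.pending p ≠ none) (hnext : A.next p (C.loc p) = .apply P w objs cont) :
      Step A C (.step p)
        { mem := Function.extend objs (P.update (fun i => C.mem (objs i)) w) C.mem
          loc := Function.update C.loc p (cont (P.response (fun i => C.mem (objs i)) w))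
          pending := C.pending }
  | respond (C : A.Config) (p : Fin n) (x : ℝ) (s : A.State)
      (hp : C.pending p ≠ none) (hnext : A.next p (C.loc p) = .respond x s) :
      Step A C (.respond p x)
        { mem := C.mem
          loc := Function.update C.loc p s
          pending := Function.update C.pending p none }

/-- `A.Run C E C'`: the finite execution fragment `E` is possible from `C` and leads to `C'`. -/
inductive Run (A : Implementation.{u} n) : A.Config → List (Event n) → A.Config → Prop
  | nil (C : A.Config) : Run A C [] C
  | cons {C C' C'' : A.Config} {e : Event n} {E : List (Event n)} :
      A.Step C e C' → Run A C' E C'' → Run A C (e :: E) C''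

/-- A finite execution: an execution fragment that starts from the initial configuration. -/
def IsExecution (A : Implementation.{u} n) (E : List (Event n)) : Prop :=
  ∃ C, A.Run A.init E C

/-- All primitives that the algorithm may apply are reads, writes, and conditional primitives of arity
at most `q`. -/
def UsesPrimitives (A : Implementation.{u} n) (q : ℕ) : Prop :=
  ∀ p s P w objs cont, A.next p s = .apply P w objs cont →
    P.IsRead ∨ P.IsWrite ∨ (P.IsConditional ∧ P.arity ≤ q)

/-- Solo termination (obstruction freedom): after any execution, a process that has a pending
operation completes it if it runs alone for sufficiently many steps. -/
def SoloTerminating (A : Implementation.{u} n) : Prop :=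
  ∀ E C, A.Run A.init E C → ∀ p, C.pending p ≠ none →
    ∃ F C', A.Run C F C' ∧ (∀ e ∈ F, e = .step p ∨ ∃ x, e = .respond p x) ∧ C'.pending p = none

end Implementation

/-! Operation instances of an execution `E` are identified with the positions in `E` at which they are
invoked. -/

variable {n : ℕ}

/-- Position `i` of `E` lies at the invocation of an instance of `op` by `p`. -/
def IsInstance (E : List (Event n)) (i : ℕ) (p : Fin n) (op : CounterOp) : Prop :=
  E[i]? = some (.invoke p op)

/-- After position `i` and before position `j` there is no response of `p`. -/
def NoResponseBetween (E : List (Event n)) (p : Fin n) (i j : ℕ) : Prop :=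
  ∀ m, i < m → m < j → ∀ x, E[m]? ≠ some (.respond p x)

/-- The operation instance `i` completes at position `j` with response `x`. -/
def CompletesAt (E : List (Event n)) (i j : ℕ) (x : ℝ) : Prop :=
  ∃ p op, IsInstance E i p op ∧ i < j ∧ E[j]? = some (.respond p x) ∧ NoResponseBetween E p i j

/-- The response of the instance `i` appears before the invocation of the instance `i'`. -/
def Precedes (E : List (Event n)) (i i' : ℕ) : Prop :=
  ∃ j x, CompletesAt E i j x ∧ j < i'

/-- The sequential specification of the `k`-multiplicative-accurate counter: a read that is preceded by
`v` increments returns some `x` with `v / k ≤ x ≤ v * k`. -/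
def SeqSpec (k : ℝ) (L : List (CounterOp × ℝ)) : Prop :=
  ∀ L₁ L₂ x, L = L₁ ++ (CounterOp.read, x) :: L₂ → ∀ v : ℕ,
    v = (L₁.filter fun a => a.1 matches .increment).length → v / k ≤ x ∧ x ≤ v * k

/-- `L`, a sequence of triples (operation instance, operation, response), is a linearization of `E`: it
consists of distinct operation instances of `E`, contains all complete ones with the responses that
they have in `E` (and possibly some incomplete ones with suitable responses), extends the real-time
order, and satisfies the sequential specification. -/
def IsLinearization (k : ℝ) (E : List (Event n)) (L : List (ℕ × CounterOp × ℝ)) : Prop :=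
  (L.map (·.1)).Nodup ∧
  (∀ a ∈ L, ∃ p, IsInstance E a.1 p a.2.1) ∧
  (∀ i j x, CompletesAt E i j x → ∃ op, (i, op, x) ∈ L) ∧
  L.Pairwise (fun a b => ¬ Precedes E b.1 a.1) ∧
  SeqSpec k (L.map (·.2))

/-- Every finite execution of `A` has a linearization with respect to the sequential specification of
the `k`-multiplicative-accurate counter. -/
def Implementation.IsMultCounter (A : Implementation.{u} n) (k : ℝ) : Prop :=
  ∀ E, A.IsExecution E → ∃ L, IsLinearization k E L

/-- The number of events of `E` that apply a primitive (invocations and responses do not count). -/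
def numSteps (E : List (Event n)) : ℕ :=
  (E.filter fun e => e matches .step _).length

/-- The operations that the process `p` invokes in `E`, in order. -/
def opsBy (E : List (Event n)) (p : Fin n) : List CounterOp :=
  E.filterMap fun e => match e with
    | .invoke p' op => if p' = p then some op else none
    | _ => none

open Classical in
/-- The set of operation instances that appear in `E`. -/
def ops (E : List (Event n)) : Finset ℕ :=
  (Finset.range E.length).filter fun i => ∃ p op, IsInstance E i p op

open Classical in
/-- The number of steps that the operation instance `i` performs in `E`. -/
def opSteps (E : List (Event n)) (i : ℕ) : ℕ :=
  ((Finset.range E.length).filter fun j => ∃ p op, IsInstance E i p op ∧ i < j ∧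
    E[j]? = some (.step p) ∧ NoResponseBetween E p i j).card

/-- The amortized step complexity: the supremum, over the finite executions in which some operation
appears, of the average number of steps performed by an operation (possibly infinite). -/
def Implementation.amtSteps (A : Implementation.{u} n) : ENNReal :=
  ⨆ (E : List (Event n)) (_ : A.IsExecution E) (_ : (ops E).Nonempty),
    ((∑ i ∈ ops E, opSteps E i : ℕ) : ENNReal) / ((ops E).card : ENNReal)

end SharedCounter

end

/-! The bound holds because information spreads slowly. Each process carries a set `aware` of
processes that may have influenced it, and each object a set `fam` of processes that can be learned
of from its value. An event depends only on the past of its process and of the objects it consults,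
so deleting everything outside the causal past of a process leaves an execution that this process
cannot distinguish from the original (`Snapshot.Good.isolate`). If nobody increments twice, a read
by `p` therefore returns at most `k` times the size of `aware p`. If `m` processes completed
increments before the read began, it returns at least `m / k`. So a reader cannot respond before it
is aware of `m / k ^ 2` processes (`Snapshot.Good.card_le`).

The schedule consists of rounds in which every pending process responds or takes a step, and a round
multiplies the sizes of all these sets by at most `(q + 1) ^ 2` (`Snapshot.Good.round`). The order
within a round matters. Primitives that change nothing go first, while the sets at the objects are
still small. Conditional primitives that would change the current values follow: each has that
vector as its only change point, so once one of its objects has changed it changes nothing, and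
knowledge cannot accumulate along a chain. Writes come last; they teach the writer nothing and leave
only the writer's knowledge behind.

Run `r` such rounds of increments. Either half of the processes are still incrementing and have
taken `r` steps each, or half have finished. In the second case these start reads, and as long as
`(q + 1) ^ (4 * r) * k ^ 2 < n / 2` none of the reads can end within another `r` rounds
(`exists_execution_of_rounds`). Both cases cost about `n * r / 2` steps, with `r` of order
`log_{q+1} (n / k ^ 2)`. When the logarithm is bounded, it suffices that every process takes a step
(`exists_execution_of_sq_lt`). -/

namespace SharedCounter

variable {n : ℕ}

/-! ### Executions, operation instances and step counts -/

/-- The process that an event belongs to. -/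
def Event.proc : Event n → Fin n
  | .invoke p _ => p
  | .step p => p
  | .respond p _ => p

namespace Implementation

variable {A : Implementation.{u} n}

theorem Run.append {C C' C'' : A.Config} {E F : List (Event n)} (h : A.Run C E C')
    (h' : A.Run C' F C'') : A.Run C (E ++ F) C'' := by
  induction h with
  | nil => exact h'
  | cons hs _ ih => exact .cons hs (ih h')

theorem Run.snoc {C C' C'' : A.Config} {E : List (Event n)} {e : Event n} (h : A.Run C E C')
    (h' : A.Step C' e C'') : A.Run C (E ++ [e]) C'' :=
  h.append (.cons h' (.nil _))

theorem Run.split {C C'' : A.Config} {E F : List (Event n)} (h : A.Run C (E ++ F) C'') :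
    ∃ C', A.Run C E C' ∧ A.Run C' F C'' := by
  induction E generalizing C with
  | nil => exact ⟨C, .nil _, h⟩
  | cons e E ih =>
    cases h with
    | cons hs hr =>
      obtain ⟨C', h1, h2⟩ := ih hr
      exact ⟨C', .cons hs h1, h2⟩

theorem Run.split_snoc {C C'' : A.Config} {E : List (Event n)} {e : Event n}
    (h : A.Run C (E ++ [e]) C'') : ∃ C', A.Run C E C' ∧ A.Step C' e C'' := by
  obtain ⟨C', h1, h2⟩ := h.split
  cases h2 with
  | cons hs hr => cases hr; exact ⟨C', h1, hs⟩

theorem Step.frame {C C' : A.Config} {e : Event n} (h : A.Step C e C') {p : Fin n}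
    (hp : p ≠ e.proc) : C'.loc p = C.loc p ∧ C'.pending p = C.pending p := by
  cases h <;> simp_all [Event.proc, Function.update_of_ne]

/-- An operation instance is either completed, or it is pending and has not been answered. -/
theorem Run.instance_cases {E : List (Event n)} {C : A.Config} (h : A.Run A.init E C) {i : ℕ}
    {p : Fin n} {op : CounterOp} (hi : IsInstance E i p op) :
    (∃ j x, CompletesAt E i j x) ∨
      (C.pending p = some op ∧ ∀ m, i < m → ∀ x, E[m]? ≠ some (.respond p x)) := by
  induction E using List.reverseRecOn generalizing C with
  | nil => simp [IsInstance] at hi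
  | append_singleton E e ih =>
    obtain ⟨C', h1, hs⟩ := h.split_snoc
    have hlen : i < (E ++ [e]).length := (List.getElem?_eq_some_iff.1 hi).1
    rw [List.length_append, List.length_singleton] at hlen
    rcases Nat.lt_or_ge i E.length with hlt | hge
    · have hi' : IsInstance E i p op := by
        rwa [IsInstance, List.getElem?_append_left hlt] at hi
      rcases ih h1 hi' with ⟨j, x, p', op', h3, h4, h5, h6⟩ | ⟨hpend, hno⟩
      · have hj : j < E.length := (List.getElem?_eq_some_iff.1 h5).1
        refine .inl ⟨j, x, p', op', ?_, h4, ?_, ?_⟩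
        · rwa [IsInstance, List.getElem?_append_left hlt]
        · rwa [List.getElem?_append_left hj]
        · intro m h7 h8
          rw [List.getElem?_append_left (h8.trans hj)]
          exact h6 m h7 h8
      · by_cases he : ∃ x, e = .respond p x
        · obtain ⟨x, rfl⟩ := he
          refine .inl ⟨E.length, x, p, op, hi, hlt, by simp, ?_⟩
          intro m h7 h8
          rw [List.getElem?_append_left h8]
          exact hno m h7
        · push Not at he
          refine .inr ⟨?_, ?_⟩
          · cases hs with
            | invoke p' op' hp =>
              have : p ≠ p' := by rintro rfl; simp [hpend] at hp
              simp [Function.update_of_ne this, hpend]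
            | step => exact hpend
            | respond p' x s =>
              have : p ≠ p' := by rintro rfl; exact he x rfl
              simp [Function.update_of_ne this, hpend]
          · intro m h7 x h8
            rcases Nat.lt_or_ge m E.length with hm | hm
            · rw [List.getElem?_append_left hm] at h8
              exact hno m h7 x h8
            · have := (List.getElem?_eq_some_iff.1 h8).1
              rw [List.length_append, List.length_singleton] at this
              obtain rfl : m = E.length := by omega
              simp at h8
              exact he x h8
    · obtain rfl : i = E.length := by omega
      simp [IsInstance] at hi
      subst hi
      refine .inr ⟨?_, ?_⟩
      · cases hs; simp
      · intro m h7 x h8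
        have := (List.getElem?_eq_some_iff.1 h8).1
        rw [List.length_append, List.length_singleton] at this
        omega

/-- A pending operation has been invoked and not been answered. -/
theorem Run.exists_instance {E : List (Event n)} {C : A.Config} (h : A.Run A.init E C)
    {p : Fin n} {op : CounterOp} (hp : C.pending p = some op) :
    ∃ i, IsInstance E i p op ∧ ∀ m, i < m → ∀ x, E[m]? ≠ some (.respond p x) := by
  induction E using List.reverseRecOn generalizing C with
  | nil => cases h; simp [init] at hp
  | append_singleton E e ih =>
    obtain ⟨C', h1, hs⟩ := h.split_snoc
    have old (hp' : C'.pending p = some op) (he : ∀ x, e ≠ .respond p x) :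
        ∃ i, IsInstance (E ++ [e]) i p op ∧
          ∀ m, i < m → ∀ x, (E ++ [e])[m]? ≠ some (.respond p x) := by
      obtain ⟨i, hi, hno⟩ := ih h1 hp'
      have hlt : i < E.length := (List.getElem?_eq_some_iff.1 hi).1
      refine ⟨i, by rwa [IsInstance, List.getElem?_append_left hlt], ?_⟩
      intro m h7 x h8
      rcases Nat.lt_or_ge m E.length with hm | hm
      · rw [List.getElem?_append_left hm] at h8
        exact hno m h7 x h8
      · have := (List.getElem?_eq_some_iff.1 h8).1
        rw [List.length_append, List.length_singleton] at this
        obtain rfl : m = E.length := by omega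
        simp at h8
        exact he x h8
    cases hs with
    | invoke p' op' hp' =>
      by_cases hpp : p = p'
      · subst hpp
        simp at hp
        subst hp
        refine ⟨E.length, by simp [IsInstance], ?_⟩
        intro m h7 x h8
        have := (List.getElem?_eq_some_iff.1 h8).1
        rw [List.length_append, List.length_singleton] at this
        omega
      · exact old (by simpa [Function.update_of_ne hpp] using hp) (by simp)
    | step => exact old hp (by simp)
    | respond p' x s =>
      by_cases hpp : p = p'
      · subst hpp; simp at hp
      · exact old (by simpa [Function.update_of_ne hpp] using hp)
          (by rintro x h; cases h; exact hpp rfl)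

end Implementation

theorem mem_opsBy {E : List (Event n)} {p : Fin n} {op : CounterOp} :
    op ∈ opsBy E p ↔ Event.invoke p op ∈ E := by
  simp only [opsBy, List.mem_filterMap]
  constructor
  · rintro ⟨e, he, h⟩
    cases e with
    | invoke p' op' =>
      simp only [Option.ite_none_right_eq_some, Option.some.injEq] at h
      obtain ⟨rfl, rfl⟩ := h
      exact he
    | step => simp at h
    | respond => simp at h
  · intro h
    exact ⟨_, h, by simp⟩

theorem opsBy_append (E F : List (Event n)) (p : Fin n) :
    opsBy (E ++ F) p = opsBy E p ++ opsBy F p := by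
  simp [opsBy]

theorem opsBy_sublist {E F : List (Event n)} (h : E.Sublist F) (p : Fin n) :
    (opsBy E p).Sublist (opsBy F p) :=
  h.filterMap _

/-- The number of steps of the process `p` in `E`. -/
def stepsBy (E : List (Event n)) (p : Fin n) : ℕ :=
  E.countP fun e => match e with
    | .step p' => decide (p' = p)
    | _ => false

theorem stepsBy_append (E F : List (Event n)) (p : Fin n) :
    stepsBy (E ++ F) p = stepsBy E p + stepsBy F p := by
  simp [stepsBy]

theorem numSteps_append (E F : List (Event n)) :
    numSteps (E ++ F) = numSteps E + numSteps F := by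
  simp [numSteps]

theorem sum_stepsBy (E : List (Event n)) : ∑ p, stepsBy E p = numSteps E := by
  induction E with
  | nil => simp [stepsBy, numSteps]
  | cons e E ih =>
    rw [← List.singleton_append, numSteps_append, ← ih]
    simp_rw [stepsBy_append]
    rw [Finset.sum_add_distrib]
    congr 1
    cases e <;> simp [stepsBy, numSteps, List.countP_cons]

theorem IsInstance.append {E F : List (Event n)} {i : ℕ} {p : Fin n} {op : CounterOp}
    (h : IsInstance E i p op) : IsInstance (E ++ F) i p op := by
  have hlt : i < E.length := (List.getElem?_eq_some_iff.1 h).1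
  rwa [IsInstance, List.getElem?_append_left hlt]

theorem CompletesAt.append {E F : List (Event n)} {i j : ℕ} {x : ℝ}
    (h : CompletesAt E i j x) : CompletesAt (E ++ F) i j x := by
  obtain ⟨p, op, h1, h2, h3, h4⟩ := h
  have hj : j < E.length := (List.getElem?_eq_some_iff.1 h3).1
  refine ⟨p, op, h1.append, h2, by rwa [List.getElem?_append_left hj], ?_⟩
  intro m h7 h8
  rw [List.getElem?_append_left (h8.trans hj)]
  exact h4 m h7 h8

theorem IsInstance.mem_opsBy {E : List (Event n)} {i : ℕ} {p : Fin n} {op : CounterOp}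
    (h : IsInstance E i p op) : op ∈ opsBy E p :=
  SharedCounter.mem_opsBy.2 (List.mem_of_getElem? h)

theorem IsInstance.unique {E : List (Event n)} {i : ℕ} {p p' : Fin n} {op op' : CounterOp}
    (h : IsInstance E i p op) (h' : IsInstance E i p' op') : p = p' ∧ op = op' := by
  have := h.symm.trans h'
  simpa using this

/-- If `p` invokes `op` at most once, then the position of the invocation is determined. -/
theorem IsInstance.eq_of_not_sublist {E : List (Event n)} {i i' : ℕ} {p : Fin n} {op : CounterOp}
    (hc : ¬ [op, op].Sublist (opsBy E p))
    (h : IsInstance E i p op) (h' : IsInstance E i' p op) : i = i' := by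
  by_contra hne
  wlog hlt : i < i' generalizing i i'
  · exact this h' h (Ne.symm hne) (by omega)
  obtain ⟨hl, he⟩ := List.getElem?_eq_some_iff.1 h
  obtain ⟨hl', he'⟩ := List.getElem?_eq_some_iff.1 h'
  have e1 : E = E.take i ++ (.invoke p op :: ((E.take i').drop (i + 1) ++
      (.invoke p op :: E.drop (i' + 1)))) := by
    conv_lhs => rw [← List.take_append_drop i' E, List.drop_eq_getElem_cons hl', he']
    have : E.take i' = E.take i ++ (.invoke p op :: (E.take i').drop (i + 1)) := by
      conv_lhs => rw [← List.take_append_drop i (E.take i'),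
        List.drop_eq_getElem_cons (by simp; omega)]
      simp [List.take_take, min_eq_left hlt.le, he]
    conv_lhs => rw [this]
    simp
  have hsub : [Event.invoke p op, .invoke p op].Sublist E := by
    rw [e1]
    exact List.Sublist.trans (((List.Sublist.cons_cons _ (List.nil_sublist _)).trans
      (List.sublist_append_right _ _)).cons_cons _) (List.sublist_append_right _ _)
  exact hc (by simpa [opsBy] using opsBy_sublist hsub p)

/-! ### Causal pasts and replay in isolation -/

open Classical in
/-- The events of `E` at the positions in `S`. -/
noncomputable def restrict (S : Set ℕ) (E : List (Event n)) : List (Event n) :=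
  (E.zipIdx.filter fun a => decide (a.2 ∈ S)).map Prod.fst

open Classical in
theorem restrict_snoc (S : Set ℕ) (E : List (Event n)) (e : Event n) :
    restrict S (E ++ [e]) = restrict S E ++ if E.length ∈ S then [e] else [] := by
  by_cases h : E.length ∈ S <;> simp [restrict, List.zipIdx_append, h]

theorem restrict_sublist (S : Set ℕ) (E : List (Event n)) : (restrict S E).Sublist E := by
  have := (List.filter_sublist (l := E.zipIdx) (p := fun a => Classical.propDecidable (a.2 ∈ S) |>.decide)).map Prod.fst
  rwa [List.zipIdx_map_fst] at this

theorem exists_of_mem_restrict {S : Set ℕ} {E : List (Event n)} {e : Event n}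
    (h : e ∈ restrict S E) : ∃ m ∈ S, E[m]? = some e := by
  simp only [restrict, List.mem_map, List.mem_filter, decide_eq_true_eq] at h
  obtain ⟨⟨e', m⟩, ⟨h1, h2⟩, rfl⟩ := h
  exact ⟨m, h2, by simpa using List.mem_zipIdx_iff_getElem?.1 h1⟩

namespace Implementation

/-- A finite execution, together with upper bounds on the set of processes that every process is
aware of and on the set of processes that can be learned of by accessing an object. -/
structure Snapshot (A : Implementation.{u} n) where
  hist : List (Event n)
  cfg : A.Config
  aware : Fin n → Finset (Fin n)
  fam : A.Obj → Finset (Fin n)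

variable {A : Implementation.{u} n}

/-- The causal pasts `past` and `pastObj` of the processes and of the values of the objects are sets of
positions closed under the dependence `dep`, and any closed set of events can be replayed in
isolation. -/
structure Snapshot.IsCausal (S : A.Snapshot) (dep : ℕ → Set ℕ) (past : Fin n → Set ℕ)
    (pastObj : A.Obj → Set ℕ) : Prop where
  dep_eq : ∀ m, S.hist.length ≤ m → dep m = ∅
  past_closed : ∀ p, ∀ m ∈ past p, dep m ⊆ past p
  past_aware : ∀ p, ∀ m ∈ past p, ∃ e, S.hist[m]? = some e ∧ e.proc ∈ S.aware p
  obj_closed : ∀ o, ∀ m ∈ pastObj o, dep m ⊆ pastObj o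
  obj_fam : ∀ o, ∀ m ∈ pastObj o, ∃ e, S.hist[m]? = some e ∧ e.proc ∈ S.fam o
  replay : ∀ T : Set ℕ, (∀ m ∈ T, dep m ⊆ T) → ∃ D, A.Run A.init (restrict T S.hist) D ∧
    (∀ p, past p ⊆ T → D.loc p = S.cfg.loc p ∧ D.pending p = S.cfg.pending p) ∧
    (∀ o, pastObj o ⊆ T → D.mem o = S.cfg.mem o)

/-- The bounds of the snapshot `S` are valid. -/
structure Snapshot.Good (S : A.Snapshot) : Prop where
  run : A.Run A.init S.hist S.cfg
  mem_aware : ∀ p, p ∈ S.aware p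
  causal : ∃ dep past pastObj, S.IsCausal dep past pastObj

theorem Snapshot.good_init : (⟨[], A.init, fun p => {p}, fun _ => ∅⟩ : A.Snapshot).Good where
  run := .nil _
  mem_aware := by simp
  causal := ⟨fun _ => ∅, fun _ => ∅, fun _ => ∅, by simp, by simp, by simp, by simp, by simp,
    fun T _ => ⟨A.init, by simpa [restrict] using .nil _, by simp⟩⟩

/-- A process is unable to distinguish an execution from one in which only the processes it is aware of
participate. -/
theorem Snapshot.Good.isolate {S : A.Snapshot} (h : S.Good) (p : Fin n) :
    ∃ E D, A.Run A.init E D ∧ E.Sublist S.hist ∧ (∀ e ∈ E, e.proc ∈ S.aware p) ∧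
      D.loc p = S.cfg.loc p ∧ D.pending p = S.cfg.pending p := by
  obtain ⟨dep, past, pastObj, hc⟩ := h.causal
  obtain ⟨D, h1, h2, -⟩ := hc.replay (past p) (hc.past_closed p)
  refine ⟨_, D, h1, restrict_sublist _ _, ?_, h2 p subset_rfl⟩
  intro e he
  obtain ⟨m, hm, he⟩ := exists_of_mem_restrict he
  obtain ⟨e', he', hmem⟩ := hc.past_aware p m hm
  rw [he] at he'
  cases he'
  exact hmem

/-- Extension of a snapshot by an event of the process `p` that depends on `p` and on the values of the
objects in `R`, and that determines the new values of the objects in `W`. -/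
theorem Snapshot.Good.extend {S S' : A.Snapshot} (h : S.Good) {e : Event n}
    (hhist : S'.hist = S.hist ++ [e]) (hstep : A.Step S.cfg e S'.cfg) (R W : Set A.Obj)
    (haware : ∀ p, S.aware p ⊆ S'.aware p) (hR : ∀ o ∈ R, S.fam o ⊆ S'.aware e.proc)
    (hW : ∀ o ∈ W, S'.aware e.proc ⊆ S'.fam o) (hfam : ∀ o ∉ W, S.fam o ⊆ S'.fam o)
    (hmem : ∀ o ∉ W, S'.cfg.mem o = S.cfg.mem o)
    (hdet : ∀ D : A.Config, D.loc e.proc = S.cfg.loc e.proc →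
      D.pending e.proc = S.cfg.pending e.proc → (∀ o ∈ R, D.mem o = S.cfg.mem o) →
      ∃ D', A.Step D e D' ∧ D'.loc e.proc = S'.cfg.loc e.proc ∧
        D'.pending e.proc = S'.cfg.pending e.proc ∧ (∀ o ∈ W, D'.mem o = S'.cfg.mem o) ∧
        (∀ o ∉ W, D.mem o = S.cfg.mem o → D'.mem o = S'.cfg.mem o)) : S'.Good := by
  classical
  obtain ⟨dep, past, pastObj, hc⟩ := h.causal
  -- The causal past of the new event, including its own position.
  set N : Set ℕ := insert S.hist.length (past e.proc ∪ ⋃ o ∈ R, pastObj o) with hN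
  have hlen : S'.hist.length = S.hist.length + 1 := by simp [hhist]
  have lt_past {p m} (hm : m ∈ past p) : m < S.hist.length := by
    obtain ⟨e', he', -⟩ := hc.past_aware p m hm
    exact (List.getElem?_eq_some_iff.1 he').1
  have lt_obj {o m} (hm : m ∈ pastObj o) : m < S.hist.length := by
    obtain ⟨e', he', -⟩ := hc.obj_fam o m hm
    exact (List.getElem?_eq_some_iff.1 he').1
  have hget {m : ℕ} {e' : Event n} (hm : S.hist[m]? = some e') : S'.hist[m]? = some e' := by
    rw [hhist, List.getElem?_append_left (List.getElem?_eq_some_iff.1 hm).1, hm]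
  have hdep {m} (hm : m < S.hist.length) : Function.update dep S.hist.length N m = dep m :=
    Function.update_of_ne hm.ne _ _
  have hNclosed : ∀ m ∈ N, Function.update dep S.hist.length N m ⊆ N := by
    rintro m (rfl | hm | hm)
    · simp
    · rw [hdep (lt_past hm)]
      exact (hc.past_closed _ m hm).trans (Set.subset_union_left.trans (Set.subset_insert _ _))
    · obtain ⟨o, ho, hm⟩ := Set.mem_iUnion₂.1 hm
      rw [hdep (lt_obj hm)]
      exact (hc.obj_closed _ m hm).trans ((Set.subset_biUnion_of_mem (u := pastObj) ho).trans
        (Set.subset_union_right.trans (Set.subset_insert _ _)))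
  have hNaware : ∀ m ∈ N, ∃ e', S'.hist[m]? = some e' ∧ e'.proc ∈ S'.aware e.proc := by
    rintro m (rfl | hm | hm)
    · exact ⟨e, by simp [hhist], haware _ (h.mem_aware _)⟩
    · obtain ⟨e', he', h1⟩ := hc.past_aware _ m hm
      exact ⟨e', hget he', haware _ h1⟩
    · obtain ⟨o, ho, hm⟩ := Set.mem_iUnion₂.1 hm
      obtain ⟨e', he', h1⟩ := hc.obj_fam _ m hm
      exact ⟨e', hget he', hR o ho h1⟩
  -- Only the acting process and the objects in `W` receive the past `N`. An object outside `W`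
  -- keeps its old past even if the event consulted it.
  refine ⟨hhist ▸ h.run.snoc hstep, fun p => haware p (h.mem_aware p),
    Function.update dep S.hist.length N, Function.update past e.proc N,
    fun o => if o ∈ W then N else pastObj o, ?_, ?_, ?_, ?_, ?_, ?_⟩
  · intro m hm
    rw [Function.update_of_ne (by omega), hc.dep_eq _ (by omega)]
  · intro p m hm
    by_cases hp : p = e.proc
    · subst hp
      rw [Function.update_self] at hm ⊢
      exact hNclosed m hm
    · rw [Function.update_of_ne hp] at hm ⊢
      rw [hdep (lt_past hm)]
      exact hc.past_closed p m hm
  · intro p m hm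
    by_cases hp : p = e.proc
    · subst hp
      rw [Function.update_self] at hm
      exact hNaware m hm
    · rw [Function.update_of_ne hp] at hm
      obtain ⟨e', he', h1⟩ := hc.past_aware p m hm
      exact ⟨e', hget he', haware _ h1⟩
  · intro o m hm
    by_cases ho : o ∈ W
    · simp only [ho, if_true] at hm ⊢
      exact hNclosed m hm
    · simp only [ho, if_false] at hm ⊢
      rw [hdep (lt_obj hm)]
      exact hc.obj_closed o m hm
  · intro o m hm
    by_cases ho : o ∈ W
    · simp only [ho, if_true] at hm
      obtain ⟨e', he', h1⟩ := hNaware m hm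
      exact ⟨e', he', hW o ho h1⟩
    · simp only [ho, if_false] at hm
      obtain ⟨e', he', h1⟩ := hc.obj_fam o m hm
      exact ⟨e', hget he', hfam o ho h1⟩
  · intro T hT
    have hT' : ∀ m ∈ T, dep m ⊆ T := by
      intro m hm
      rcases eq_or_ne m S.hist.length with rfl | hne
      -- `dep` was empty at the position that is now being filled, so closure under the new
      -- dependence implies closure under the old one.
      · simp [hc.dep_eq _ le_rfl]
      · have := hT m hm
        rwa [Function.update_of_ne hne] at this
    obtain ⟨D, hrun, hproc, hobj⟩ := hc.replay T hT'
    rw [hhist, restrict_snoc]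
    -- If the new event is kept, closure puts `N` into `T`, so the replay agrees on everything that
    -- determines the event. If it is dropped, nothing has to be shown for the acting process or for
    -- `W`, whose pasts contain the new position.
    by_cases hmT : S.hist.length ∈ T
    · have hNT : N ⊆ T := by simpa using hT _ hmT
      have hpT : past e.proc ⊆ T :=
        (Set.subset_union_left.trans (Set.subset_insert _ _)).trans hNT
      obtain ⟨D', hD, hl, hp, hmW, hmW'⟩ := hdet D (hproc _ hpT).1 (hproc _ hpT).2
        (fun o ho => hobj o (((Set.subset_biUnion_of_mem (u := pastObj) ho).trans
          (Set.subset_union_right.trans (Set.subset_insert _ _))).trans hNT))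
      refine ⟨D', by simpa [hmT] using hrun.snoc hD, ?_, ?_⟩
      · intro p hpast
        by_cases hpe : p = e.proc
        · subst hpe
          exact ⟨hl, hp⟩
        · rw [Function.update_of_ne hpe] at hpast
          rw [(hD.frame hpe).1, (hD.frame hpe).2, (hstep.frame hpe).1, (hstep.frame hpe).2]
          exact hproc p hpast
      · intro o hpast
        by_cases ho : o ∈ W
        · exact hmW o ho
        · simp only [ho, if_false] at hpast
          exact hmW' o ho (hobj o hpast)
    · refine ⟨D, by simpa [hmT] using hrun, ?_, ?_⟩
      · intro p hpast
        by_cases hpe : p = e.proc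
        · subst hpe
          rw [Function.update_self] at hpast
          exact absurd (hpast (Set.mem_insert _ _)) hmT
        · rw [Function.update_of_ne hpe] at hpast
          rw [(hstep.frame hpe).1, (hstep.frame hpe).2]
          exact hproc p hpast
      · intro o hpast
        by_cases ho : o ∈ W
        · simp only [ho, if_true] at hpast
          exact absurd (hpast (Set.mem_insert _ _)) hmT
        · simp only [ho, if_false] at hpast
          rw [hmem o ho]
          exact hobj o hpast

/-- Invocations touch no object, so no information flows and the bounds carry over; `R` and `W` are
empty here, as for responses. -/
theorem Snapshot.Good.invoke {S : A.Snapshot} (h : S.Good) {p : Fin n} (op : CounterOp)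
    (hp : S.cfg.pending p = none) :
    ∃ C, (⟨S.hist ++ [.invoke p op], C, S.aware, S.fam⟩ : A.Snapshot).Good ∧
      A.Step S.cfg (.invoke p op) C ∧ C.pending p = some op := by
  refine ⟨_, h.extend rfl (.invoke _ p op hp) ∅ ∅ (fun _ => subset_rfl) (by simp) (by simp)
    (fun _ _ => subset_rfl) (fun _ _ => rfl) ?_, .invoke _ p op hp, by simp⟩
  intro D h1 h2 _
  simp only [Event.proc] at h1 h2 ⊢
  exact ⟨_, .invoke D p op (by rw [h2, hp]), by simp [h1], by simp, by simp, by simp⟩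

theorem Snapshot.Good.respond {S : A.Snapshot} (h : S.Good) {p : Fin n} {x : ℝ} {s : A.State}
    (hp : S.cfg.pending p ≠ none) (hnext : A.next p (S.cfg.loc p) = .respond x s) :
    ∃ C, (⟨S.hist ++ [.respond p x], C, S.aware, S.fam⟩ : A.Snapshot).Good ∧
      A.Step S.cfg (.respond p x) C ∧ C.pending p = none := by
  refine ⟨_, h.extend rfl (.respond _ p x s hp hnext) ∅ ∅ (fun _ => subset_rfl) (by simp) (by simp)
    (fun _ _ => subset_rfl) (fun _ _ => rfl) ?_, .respond _ p x s hp hnext, by simp⟩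
  intro D h1 h2 _
  simp only [Event.proc] at h1 h2 ⊢
  exact ⟨_, .respond D p x s (by rwa [h2]) (by rwa [h1]), by simp, by simp, by simp, by simp⟩

/-- The application of a primitive makes the process aware of all processes that can be learned of from
the objects it is applied to, and reveals that knowledge in the objects whose values change. -/
theorem Snapshot.Good.step {S : A.Snapshot} (h : S.Good) {p : Fin n} {P : Primitive.{u} A.Val}
    {w : P.Input} {objs : Fin P.arity ↪ A.Obj} {cont : P.Response → A.State}
    (hp : S.cfg.pending p ≠ none) (hnext : A.next p (S.cfg.loc p) = .apply P w objs cont) :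
    ∃ S' : A.Snapshot, S'.Good ∧ S'.hist = S.hist ++ [.step p] ∧ A.Step S.cfg (.step p) S'.cfg ∧
      S'.cfg.mem = Function.extend objs (P.update (fun i => S.cfg.mem (objs i)) w) S.cfg.mem ∧
      S'.aware p = S.aware p ∪ Finset.univ.biUnion (fun i => S.fam (objs i)) ∧
      (∀ p' ≠ p, S'.aware p' = S.aware p') ∧
      (∀ o, S'.cfg.mem o ≠ S.cfg.mem o → S'.fam o = S'.aware p) ∧
      (∀ o, S'.cfg.mem o = S.cfg.mem o → S'.fam o = S.fam o) := by
  classical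
  have hs := Step.step S.cfg p P w objs cont hp hnext
  set K := S.aware p ∪ Finset.univ.biUnion (fun i => S.fam (objs i))
  set M := Function.extend objs (P.update (fun i => S.cfg.mem (objs i)) w) S.cfg.mem with hM
  refine ⟨⟨S.hist ++ [.step p], _, Function.update S.aware p K,
    fun o => if M o ≠ S.cfg.mem o then K else S.fam o⟩, ?_, rfl, hs, rfl, by simp,
    fun p' hp' => by simp [hp'], fun o ho => by simp [show M o ≠ S.cfg.mem o from ho],
    fun o ho => by simp [show M o = S.cfg.mem o from ho]⟩
  -- `W` contains only the objects whose values really change. An accessed object with an unchanged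
  -- value has the same value whether or not the event is replayed.
  refine h.extend rfl hs (Set.range objs) {o | M o ≠ S.cfg.mem o} ?_ ?_ ?_ ?_ ?_ ?_
  · intro p'
    by_cases hp' : p' = p
    · subst hp'; simp [K]
    · simp [hp']
  · rintro _ ⟨i, rfl⟩
    simp only [Event.proc, Function.update_self, K]
    exact (Finset.subset_biUnion_of_mem (fun i => S.fam (objs i)) (Finset.mem_univ i)).trans
      Finset.subset_union_right
  · intro o ho
    simp [show M o ≠ S.cfg.mem o from ho, Event.proc]
  · intro o ho
    have : M o = S.cfg.mem o := by simpa using ho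
    simp [this]
  · intro o ho
    have : M o = S.cfg.mem o := by simpa using ho
    exact this
  · intro D h1 h2 h3
    simp only [Event.proc] at h1 h2 ⊢
    have hv : (fun i => D.mem (objs i)) = fun i => S.cfg.mem (objs i) :=
      funext fun i => h3 _ ⟨i, rfl⟩
    refine ⟨_, .step D p P w objs cont (by rwa [h2]) (by rwa [h1]), by simp [hv], h2, ?_, ?_⟩
    · intro o ho
      by_cases hr : ∃ i, objs i = o
      · obtain ⟨i, rfl⟩ := hr
        simp only [hv]
        rw [hM, objs.injective.extend_apply, objs.injective.extend_apply]
      · exact absurd (Function.extend_apply' _ _ _ hr) ho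
    · intro o ho hD
      by_cases hr : ∃ i, objs i = o
      · obtain ⟨i, rfl⟩ := hr
        simp only [hv]
        rw [hM, objs.injective.extend_apply, objs.injective.extend_apply]
      · dsimp only
        rw [hM, Function.extend_apply' _ _ _ hr, Function.extend_apply' _ _ _ hr, hD]

/-- A write does not make the process aware of further processes. -/
theorem Snapshot.Good.write {S : A.Snapshot} (h : S.Good) {p : Fin n} {P : Primitive.{u} A.Val}
    {w : P.Input} {objs : Fin P.arity ↪ A.Obj} {cont : P.Response → A.State}
    (hp : S.cfg.pending p ≠ none) (hnext : A.next p (S.cfg.loc p) = .apply P w objs cont)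
    (hP : P.IsWrite) :
    ∃ S' : A.Snapshot, S'.Good ∧ S'.hist = S.hist ++ [.step p] ∧ A.Step S.cfg (.step p) S'.cfg ∧
      S'.aware = S.aware ∧ ∀ o, S'.fam o = S.aware p ∨ S'.fam o = S.fam o := by
  classical
  have hs := Step.step S.cfg p P w objs cont hp hnext
  obtain ⟨-, hP⟩ := hP
  obtain ⟨d, r, hP⟩ := hP w
  refine ⟨⟨S.hist ++ [.step p], _, S.aware,
    fun o => if o ∈ Set.range objs then S.aware p else S.fam o⟩, ?_, rfl, hs, rfl,
    fun o => ite_eq_or_eq _ _ _⟩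
  -- Nothing is consulted, since both the response and the installed value depend on the input
  -- alone. The overwritten object loses its old past, even if its value happens to stay the same.
  refine h.extend rfl hs ∅ (Set.range objs) (fun _ => subset_rfl) (by simp) ?_ ?_ ?_ ?_
  · intro o ho
    simp only [ho, if_true, Event.proc]
    exact subset_rfl
  · intro o ho
    simp only [ho, if_false]
    exact subset_rfl
  · intro o ho
    exact Function.extend_apply' _ _ _ ho
  · intro D h1 h2 _
    simp only [Event.proc] at h1 h2 ⊢
    refine ⟨_, .step D p P w objs cont (by rwa [h2]) (by rwa [h1]), by simp [(hP _).2], h2, ?_, ?_⟩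
    · rintro _ ⟨i, rfl⟩
      simp only [(hP _).1]
      rw [objs.injective.extend_apply, objs.injective.extend_apply]
    · intro o ho hD
      dsimp only
      rw [Function.extend_apply' _ _ _ ho, Function.extend_apply' _ _ _ ho, hD]

end Implementation

/-! ### What a read must know -/

/-- The increments that a linearization puts before a completed read. -/
theorem IsLinearization.exists_counted {k : ℝ} {E : List (Event n)} {L : List (ℕ × CounterOp × ℝ)}
    (hL : IsLinearization k E L) {i j : ℕ} {x : ℝ} {p : Fin n} (hi : IsInstance E i p .read)
    (hx : CompletesAt E i j x) :
    ∃ V : Finset ℕ, (V.card : ℝ) / k ≤ x ∧ x ≤ V.card * k ∧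
      (∀ a ∈ V, ∃ p', IsInstance E a p' .increment) ∧
      (∀ a p' j' y, IsInstance E a p' .increment → CompletesAt E a j' y → j' < i → a ∈ V) := by
  obtain ⟨hnodup, hinst, hcomp, hpair, hspec⟩ := hL
  obtain ⟨op, hop⟩ := hcomp i j x hx
  obtain ⟨p₁, hp₁⟩ := hinst _ hop
  obtain rfl : op = .read := (hp₁.unique hi).2
  obtain ⟨L₁, L₂, rfl⟩ := List.append_of_mem hop
  set M := (L₁.filter fun a => a.2.1 matches .increment).map (·.1) with hM
  have hMn : M.Nodup := by
    rw [List.map_append, List.nodup_append] at hnodup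
    exact hnodup.1.sublist (List.filter_sublist.map _)
  have hcard : M.toFinset.card =
      ((L₁.map (·.2)).filter fun a => a.1 matches .increment).length := by
    rw [List.toFinset_card_of_nodup hMn, hM, List.filter_map, List.length_map, List.length_map]
    rfl
  have hsp := hspec (L₁.map (·.2)) (L₂.map (·.2)) x (by simp) _ hcard
  refine ⟨M.toFinset, hsp.1, hsp.2, ?_, ?_⟩
  · intro a ha
    simp only [hM, List.mem_toFinset, List.mem_map, List.mem_filter] at ha
    obtain ⟨⟨a', op, y⟩, ⟨h1, h2⟩, rfl⟩ := ha
    obtain ⟨p', hp'⟩ := hinst (a', op, y) (by simp [h1])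
    cases op with
    | increment => exact ⟨p', hp'⟩
    | read => simp at h2
  · intro a p' j' y ha hy hlt
    obtain ⟨op, hmem⟩ := hcomp a j' y hy
    obtain ⟨p₂, hp₂⟩ := hinst _ hmem
    obtain rfl : op = .increment := (hp₂.unique ha).2
    rw [List.mem_append, List.mem_cons] at hmem
    rcases hmem with h | h | h
    · simp only [hM, List.mem_toFinset, List.mem_map, List.mem_filter]
      exact ⟨_, ⟨h, rfl⟩, rfl⟩
    · simp at h
    · rw [List.pairwise_append] at hpair
      -- Placing the increment after the read would violate the real-time order.
      exact absurd ⟨j', y, hy, hlt⟩ ((List.pairwise_cons.1 hpair.2.1).1 _ h)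

namespace Implementation

variable {A : Implementation.{u} n}

/-- A response completes the pending operation. -/
theorem Run.completesAt {E : List (Event n)} {p : Fin n} {op : CounterOp} {i : ℕ}
    (hi : IsInstance E i p op) (hno : ∀ m, i < m → ∀ x, E[m]? ≠ some (.respond p x)) (x : ℝ) :
    CompletesAt (E ++ [.respond p x]) i E.length x := by
  refine ⟨p, op, hi.append, (List.getElem?_eq_some_iff.1 hi).1, by simp, ?_⟩
  intro m h1 h2
  rw [List.getElem?_append_left h2]
  exact hno m h1

/-- In the isolated execution the reader gives the same response, but only processes in `aware p`
can have incremented, each at most once. The latter is expressed through sublists because that form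
passes to the isolated execution, a sublist of the history. -/
theorem Snapshot.Good.response_le {S : A.Snapshot} (h : S.Good) {k : ℝ} (hk : 0 < k)
    (hA : A.IsMultCounter k)
    (hinc : ∀ p, ¬ [CounterOp.increment, .increment].Sublist (opsBy S.hist p)) {p : Fin n} {x : ℝ}
    {s : A.State} (hp : S.cfg.pending p = some .read)
    (hnext : A.next p (S.cfg.loc p) = .respond x s) : x ≤ (S.aware p).card * k := by
  obtain ⟨E, D, hrun, hsub, hproc, hloc, hpend⟩ := h.isolate p
  rw [← hloc] at hnext
  rw [← hpend] at hp
  obtain ⟨i, hi, hno⟩ := hrun.exists_instance hp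
  obtain ⟨L, hL⟩ := hA _ ⟨_, hrun.snoc (.respond D p x s (by simp [hp]) hnext)⟩
  obtain ⟨V, -, hV, hV', -⟩ := hL.exists_counted hi.append (Run.completesAt hi hno x)
  refine hV.trans (mul_le_mul_of_nonneg_right ?_ hk.le)
  have key : ∀ a p', IsInstance (E ++ [.respond p x]) a p' .increment →
      IsInstance E a p' .increment := by
    intro a p' ha
    have hlt := (List.getElem?_eq_some_iff.1 ha).1
    rw [List.length_append, List.length_singleton] at hlt
    rcases Nat.lt_or_ge a E.length with h1 | h1
    · rwa [IsInstance, List.getElem?_append_left h1] at ha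
    · obtain rfl : a = E.length := by omega
      simp [IsInstance] at ha
  exact_mod_cast Finset.card_le_card_of_forall_subsingleton
    (fun a p' => IsInstance E a p' .increment)
    (fun a ha => by
      obtain ⟨p', hp'⟩ := hV' a ha
      have := key _ _ hp'
      exact ⟨p', hproc _ (List.mem_of_getElem? this), this⟩)
    (fun p' _ a ha b hb => IsInstance.eq_of_not_sublist
      (fun h => hinc p' (h.trans (opsBy_sublist hsub p'))) ha.2 hb.2)

/-- A process of `T` has nothing pending after `E₁`, so its increment is complete there, and the
read is invoked later. Every linearization must count these increments before the read. -/
theorem Run.le_response {E₁ E₂ : List (Event n)} {C₁ C : A.Config} (h₁ : A.Run A.init E₁ C₁)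
    (h : A.Run A.init (E₁ ++ E₂) C) {k : ℝ} (hk : 0 < k) (hA : A.IsMultCounter k)
    {T : Finset (Fin n)} (hT : ∀ p ∈ T, .increment ∈ opsBy E₁ p ∧ C₁.pending p = none) {p : Fin n}
    {x : ℝ} {s : A.State} (hread : .read ∉ opsBy E₁ p) (hp : C.pending p = some .read)
    (hnext : A.next p (C.loc p) = .respond x s) : (T.card : ℝ) / k ≤ x := by
  obtain ⟨i, hi, hno⟩ := h.exists_instance hp
  obtain ⟨L, hL⟩ := hA _ ⟨_, h.snoc (.respond C p x s (by simp [hp]) hnext)⟩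
  obtain ⟨V, hV, -, -, hV'⟩ := hL.exists_counted hi.append (Run.completesAt hi hno x)
  refine le_trans ((div_le_div_iff_of_pos_right hk).2 ?_) hV
  -- The read begins after `E₁`, since `p` has invoked no read in `E₁`.
  have hlen : E₁.length ≤ i := by
    by_contra hlt
    rw [IsInstance, List.getElem?_append_left (by omega)] at hi
    exact hread (IsInstance.mem_opsBy hi)
  exact_mod_cast Finset.card_le_card_of_forall_subsingleton
    (fun p' a => IsInstance E₁ a p' .increment)
    (fun p' hp' => by
      obtain ⟨h2, h3⟩ := hT p' hp'
      obtain ⟨a, ha⟩ := List.mem_iff_getElem?.1 (mem_opsBy.1 h2)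
      have ha : IsInstance E₁ a p' .increment := ha
      rcases h₁.instance_cases ha with ⟨j, y, hj⟩ | ⟨h4, -⟩
      · refine ⟨a, hV' a p' j y ha.append.append hj.append.append ?_, ha⟩
        obtain ⟨_, _, _, _, h5, _⟩ := hj
        have := (List.getElem?_eq_some_iff.1 h5).1
        omega
      · simp [h3] at h4)
    (fun a _ b hb c hc => (hb.2.unique hc.2).1)

/-- A process that is about to respond to a read must be aware of many processes, if many increments
were completed before that read was invoked. -/
theorem Snapshot.Good.card_le {S : A.Snapshot} (h : S.Good) {k : ℝ} (hk : 0 < k)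
    (hA : A.IsMultCounter k)
    (hinc : ∀ p, ¬ [CounterOp.increment, .increment].Sublist (opsBy S.hist p))
    {E₁ : List (Event n)} {C₁ : A.Config} (h₁ : A.Run A.init E₁ C₁) (hE : E₁ <+: S.hist)
    {T : Finset (Fin n)} (hT : ∀ p ∈ T, .increment ∈ opsBy E₁ p ∧ C₁.pending p = none) {p : Fin n}
    {x : ℝ} {s : A.State} (hread : .read ∉ opsBy E₁ p) (hp : S.cfg.pending p = some .read)
    (hnext : A.next p (S.cfg.loc p) = .respond x s) :
    (T.card : ℝ) ≤ (S.aware p).card * k ^ 2 := by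
  obtain ⟨E₂, hE⟩ := hE
  have h2 := Run.le_response h₁ (hE ▸ h.run) hk hA hT hread hp hnext
  have h3 := h2.trans (h.response_le hk hA hinc hp hnext)
  rw [div_le_iff₀ hk] at h3
  linarith

end Implementation

/-! ### One round of the schedule -/

theorem stepsBy_le_of_prefix {E F : List (Event n)} (h : E <+: F) (p : Fin n) :
    stepsBy E p ≤ stepsBy F p := by
  obtain ⟨G, rfl⟩ := h
  rw [stepsBy_append]
  exact Nat.le_add_right _ _

theorem Primitive.IsRead.isConditional {D : Type u} {P : Primitive D} (h : P.IsRead) :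
    P.IsConditional := by
  intro w
  simp [h.2]

/-- A conditional primitive that changes the vector `v` does not change any other vector. -/
theorem Primitive.IsConditional.update_eq {D : Type u} {P : Primitive D} (h : P.IsConditional)
    {w : P.Input} {v v' : Fin P.arity → D} (hv : P.update v w ≠ v) (hne : v' ≠ v) :
    P.update v' w = v' := by
  by_contra hv'
  exact hne (Set.encard_le_one_iff.1 (h w) v' v hv' hv)

namespace Implementation

variable {A : Implementation.{u} n}

/-- `S'` extends `S` by steps of the processes in `Q`, at least one of each. -/
structure Snapshot.Turn (S S' : A.Snapshot) (Q : Finset (Fin n)) : Prop where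
  good : S'.Good
  hist : S.hist <+: S'.hist
  opsBy_eq : ∀ p, opsBy S'.hist p = opsBy S.hist p
  steps : ∀ p ∈ Q, stepsBy S.hist p + 1 ≤ stepsBy S'.hist p
  pending : S'.cfg.pending = S.cfg.pending
  loc : ∀ p ∉ Q, S'.cfg.loc p = S.cfg.loc p
  aware : ∀ p ∉ Q, S'.aware p = S.aware p

theorem Snapshot.Good.turn {S : A.Snapshot} (h : S.Good) : S.Turn S ∅ :=
  ⟨h, List.prefix_refl _, fun _ => rfl, by simp, rfl, fun _ _ => rfl, fun _ _ => rfl⟩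

theorem Snapshot.Turn.trans {S S' S'' : A.Snapshot} {Q Q' : Finset (Fin n)} (h : S.Turn S' Q)
    (h' : S'.Turn S'' Q') : S.Turn S'' (Q ∪ Q') where
  good := h'.good
  hist := h.hist.trans h'.hist
  opsBy_eq p := (h'.opsBy_eq p).trans (h.opsBy_eq p)
  steps p hp := by
    rcases Finset.mem_union.1 hp with hp | hp
    · exact (h.steps p hp).trans (stepsBy_le_of_prefix h'.hist p)
    · exact (Nat.add_le_add_right (stepsBy_le_of_prefix h.hist p) 1).trans (h'.steps p hp)
  pending := h'.pending.trans h.pending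
  loc p hp := by
    rw [Finset.mem_union, not_or] at hp
    rw [h'.loc p hp.2, h.loc p hp.1]
  aware p hp := by
    rw [Finset.mem_union, not_or] at hp
    rw [h'.aware p hp.2, h.aware p hp.1]

theorem Snapshot.Turn.snoc {S S' S'' : A.Snapshot} {Q : Finset (Fin n)} (h : S.Turn S' Q)
    {p : Fin n} (hgood : S''.Good) (hhist : S''.hist = S'.hist ++ [.step p])
    (hstep : A.Step S'.cfg (.step p) S''.cfg) (haware : ∀ p' ≠ p, S''.aware p' = S'.aware p') :
    S.Turn S'' (insert p Q) := by
  rw [Finset.insert_eq, Finset.union_comm]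
  refine h.trans ⟨hgood, hhist ▸ List.prefix_append _ _, ?_, ?_, ?_, ?_, ?_⟩
  · intro p'
    rw [hhist, opsBy_append]
    simp [opsBy]
  · intro p' hp'
    obtain rfl := Finset.mem_singleton.1 hp'
    rw [hhist, stepsBy_append]
    simp [stepsBy]
  · generalize S''.cfg = C at hstep
    cases hstep
    rfl
  · intro p' hp'
    exact (hstep.frame (by simpa [Event.proc] using hp')).1
  · intro p' hp'
    exact haware p' (by simpa using hp')

/-- The growth estimate for one primitive application: a process with knowledge of size `M` consults
at most `q` objects, each revealing at most `M'` processes. -/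
theorem card_union_biUnion_le {α : Type*} {a q M M' : ℕ} (ha : a ≤ q) (K : Finset (Fin n))
    (F : α → Finset (Fin n)) (f : Fin a → α) (hK : K.card ≤ M) (hF : ∀ i, (F (f i)).card ≤ M') :
    (K ∪ Finset.univ.biUnion fun i => F (f i)).card ≤ M + q * M' := by
  refine (Finset.card_union_le _ _).trans (Nat.add_le_add hK ?_)
  refine (Finset.card_biUnion_le_card_mul _ _ M' fun i _ => hF i).trans ?_
  simpa using Nat.mul_le_mul_right M' ha

/-- Scheduling of primitive applications that do not change any value. -/
theorem Snapshot.Good.turn_invisible {S : A.Snapshot} (h : S.Good) {q M : ℕ}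
    (hK : ∀ p, (S.aware p).card ≤ M) (hF : ∀ o, (S.fam o).card ≤ M) (Q : Finset (Fin n))
    (hQ : ∀ p ∈ Q, S.cfg.pending p ≠ none ∧ ∃ P w objs cont,
      A.next p (S.cfg.loc p) = .apply P w objs cont ∧ P.arity ≤ q ∧
        P.update (fun i => S.cfg.mem (objs i)) w = fun i => S.cfg.mem (objs i)) :
    ∃ S', S.Turn S' Q ∧ S'.cfg.mem = S.cfg.mem ∧ S'.fam = S.fam ∧
      ∀ p, (S'.aware p).card ≤ (q + 1) * M := by
  induction Q using Finset.induction_on with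
  | empty =>
    refine ⟨S, h.turn, rfl, rfl, fun p => (hK p).trans ?_⟩
    exact Nat.le_mul_of_pos_left _ (Nat.succ_pos _)
  | insert p Q hp ih =>
    obtain ⟨S', hturn, hmem, hfam, haware⟩ := ih fun p' hp' => hQ p' (Finset.mem_insert_of_mem hp')
    obtain ⟨hpend, P, w, objs, cont, hnext, harity, hupd⟩ := hQ p (Finset.mem_insert_self _ _)
    rw [← hturn.pending] at hpend
    rw [← hturn.loc p hp] at hnext
    rw [← hmem] at hupd
    obtain ⟨S'', h1, h2, h3, h4, h5, h6, -, h8⟩ := hturn.good.step hpend hnext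
    have hmem' : S''.cfg.mem = S'.cfg.mem := by
      rw [h4, hupd]
      funext o
      by_cases hr : ∃ i, objs i = o
      · obtain ⟨i, rfl⟩ := hr
        rw [objs.injective.extend_apply]
      · rw [Function.extend_apply' _ _ _ hr]
    refine ⟨S'', hturn.snoc h1 h2 h3 h6, hmem'.trans hmem, ?_, ?_⟩
    · rw [← hfam]
      exact funext fun o => h8 o (congrFun hmem' o)
    · intro p'
      by_cases hp' : p' = p
      · subst hp'
        rw [h5, hturn.aware p' hp, hfam]
        refine (card_union_biUnion_le harity _ _ _ (hK p') fun i => hF _).trans (le_of_eq ?_)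
        ring
      · rw [h6 p' hp']
        exact haware p'

/-- Scheduling of conditional primitives that would change the current values: once an object has
changed its value, the conditional primitives still to be applied to it do not change it any more. -/
theorem Snapshot.Good.turn_conditional {S : A.Snapshot} (h : S.Good) {q M : ℕ}
    (hF : ∀ o, (S.fam o).card ≤ M) (Q : Finset (Fin n)) (hK : ∀ p ∈ Q, (S.aware p).card ≤ M)
    (hQ : ∀ p ∈ Q, S.cfg.pending p ≠ none ∧ ∃ P w objs cont,
      A.next p (S.cfg.loc p) = .apply P w objs cont ∧ P.arity ≤ q ∧ P.IsConditional ∧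
        P.update (fun i => S.cfg.mem (objs i)) w ≠ fun i => S.cfg.mem (objs i)) :
    ∃ S', S.Turn S' Q ∧ (∀ o, S'.cfg.mem o = S.cfg.mem o → S'.fam o = S.fam o) ∧
      (∀ o, (S'.fam o).card ≤ (q + 1) * M) ∧ ∀ p ∈ Q, (S'.aware p).card ≤ (q + 1) ^ 2 * M := by
  induction Q using Finset.induction_on with
  | empty =>
    refine ⟨S, h.turn, fun _ _ => rfl, fun o => (hF o).trans ?_, by simp⟩
    exact Nat.le_mul_of_pos_left _ (Nat.succ_pos _)
  | insert p Q hp ih =>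
    obtain ⟨S', hturn, hsame, hfam, haware⟩ := ih (fun p' hp' => hK p' (Finset.mem_insert_of_mem hp'))
      fun p' hp' => hQ p' (Finset.mem_insert_of_mem hp')
    obtain ⟨hpend, P, w, objs, cont, hnext, harity, hcond, hupd⟩ := hQ p (Finset.mem_insert_self _ _)
    have hKp := hK p (Finset.mem_insert_self _ _)
    rw [← hturn.pending] at hpend
    rw [← hturn.loc p hp] at hnext
    rw [← hturn.aware p hp] at hKp
    obtain ⟨S'', h1, h2, h3, h4, h5, h6, h7, h8⟩ := hturn.good.step hpend hnext
    have hbound : (S''.aware p).card ≤ (q + 1) ^ 2 * M := by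
      rw [h5]
      refine (card_union_biUnion_le harity _ _ _ hKp fun i => hfam _).trans ?_
      -- The sum is `M + q * (q + 1) * M`, which falls short of `(q + 1) ^ 2 * M` by `q * M`.
      nlinarith [Nat.zero_le (q * M)]
    have haware' : ∀ p' ∈ insert p Q, (S''.aware p').card ≤ (q + 1) ^ 2 * M := by
      intro p' hp'
      by_cases hpp : p' = p
      · subst hpp
        exact hbound
      · rw [h6 p' hpp]
        exact haware p' (Finset.mem_of_mem_insert_of_ne hp' hpp)
    refine ⟨S'', hturn.snoc h1 h2 h3 h6, ?_, ?_, haware'⟩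
    -- If the accessed vector still has its value from `S`, the invariant `hsame` gives the
    -- original, small sets at its objects, and any object that now changes gets at most `(q + 1) *
    -- M` processes. Otherwise the only change point is missed and memory is untouched.
    all_goals by_cases hv : (fun i => S'.cfg.mem (objs i)) = fun i => S.cfg.mem (objs i)
    · intro o ho
      by_cases hr : ∃ i, objs i = o
      · obtain ⟨i, rfl⟩ := hr
        have hi := congrFun hv i
        rw [h8 _ (ho.trans hi.symm), hsame _ hi]
      · have : S''.cfg.mem o = S'.cfg.mem o := by rw [h4, Function.extend_apply' _ _ _ hr]
        rw [h8 _ this, hsame _ (this.symm.trans ho)]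
    · have hmem' : S''.cfg.mem = S'.cfg.mem := by
        rw [h4, hcond.update_eq hupd hv]
        funext o
        by_cases hr : ∃ i, objs i = o
        · obtain ⟨i, rfl⟩ := hr
          rw [objs.injective.extend_apply]
        · rw [Function.extend_apply' _ _ _ hr]
      intro o ho
      rw [h8 o (congrFun hmem' o)]
      exact hsame o (by rw [← ho, hmem'])
    · intro o
      by_cases ho : S''.cfg.mem o = S'.cfg.mem o
      · rw [h8 o ho]
        exact hfam o
      · rw [h7 o ho, h5]
        refine (card_union_biUnion_le harity _ _ _ hKp fun i => (?_ : _ ≤ M)).trans (le_of_eq ?_)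
        · rw [hsame _ (congrFun hv i)]
          exact hF _
        · ring
    · have hmem' : S''.cfg.mem = S'.cfg.mem := by
        rw [h4, hcond.update_eq hupd hv]
        funext o
        by_cases hr : ∃ i, objs i = o
        · obtain ⟨i, rfl⟩ := hr
          rw [objs.injective.extend_apply]
        · rw [Function.extend_apply' _ _ _ hr]
      intro o
      rw [h8 o (congrFun hmem' o)]
      exact hfam o

/-- Scheduling of writes. -/
theorem Snapshot.Good.turn_write {S : A.Snapshot} (h : S.Good) {M : ℕ}
    (hF : ∀ o, (S.fam o).card ≤ M) (hK : ∀ p, (S.aware p).card ≤ M) (Q : Finset (Fin n))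
    (hQ : ∀ p ∈ Q, S.cfg.pending p ≠ none ∧ ∃ P w objs cont,
      A.next p (S.cfg.loc p) = .apply P w objs cont ∧ P.IsWrite) :
    ∃ S', S.Turn S' Q ∧ S'.aware = S.aware ∧ ∀ o, (S'.fam o).card ≤ M := by
  induction Q using Finset.induction_on with
  | empty => exact ⟨S, h.turn, rfl, hF⟩
  | insert p Q hp ih =>
    obtain ⟨S', hturn, haware, hfam⟩ := ih fun p' hp' => hQ p' (Finset.mem_insert_of_mem hp')
    obtain ⟨hpend, P, w, objs, cont, hnext, hP⟩ := hQ p (Finset.mem_insert_self _ _)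
    rw [← hturn.pending] at hpend
    rw [← hturn.loc p hp] at hnext
    obtain ⟨S'', h1, h2, h3, h4, h5⟩ := hturn.good.write hpend hnext hP
    refine ⟨S'', hturn.snoc h1 h2 h3 fun p' _ => by rw [h4], h4.trans haware, fun o => ?_⟩
    rcases h5 o with h | h
    · rw [h, haware]
      exact hK p
    · rw [h]
      exact hfam o

/-- Responses carry no information to other processes, so they can be scheduled before the steps of
a round without affecting any bound. -/
theorem Snapshot.Good.respond_all {S : A.Snapshot} (h : S.Good) (Q : Finset (Fin n))
    (hQ : ∀ p ∈ Q, S.cfg.pending p ≠ none ∧ ∃ x s, A.next p (S.cfg.loc p) = .respond x s) :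
    ∃ S' : A.Snapshot, S'.Good ∧ S.hist <+: S'.hist ∧ (∀ p, opsBy S'.hist p = opsBy S.hist p) ∧
      S'.aware = S.aware ∧ S'.fam = S.fam ∧ (∀ p ∈ Q, S'.cfg.pending p = none) ∧
      (∀ p ∉ Q, S'.cfg.loc p = S.cfg.loc p ∧ S'.cfg.pending p = S.cfg.pending p) := by
  induction Q using Finset.induction_on with
  | empty => exact ⟨S, h, List.prefix_refl _, fun _ => rfl, rfl, rfl, by simp, by simp⟩
  | insert p Q hp ih =>
    obtain ⟨S', h1, h2, h3, h4, h5, h6, h7⟩ := ih fun p' hp' => hQ p' (Finset.mem_insert_of_mem hp')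
    obtain ⟨hpend, x, s, hnext⟩ := hQ p (Finset.mem_insert_self _ _)
    rw [← (h7 p hp).2] at hpend
    rw [← (h7 p hp).1] at hnext
    obtain ⟨C, hgood, hstep, hnone⟩ := h1.respond hpend hnext
    have hframe {p' : Fin n} (hp' : p' ≠ p) := hstep.frame (p := p') (by simpa [Event.proc] using hp')
    refine ⟨_, hgood, h2.trans (List.prefix_append _ _), ?_, h4, h5, ?_, ?_⟩
    · intro p'
      rw [opsBy_append, h3]
      simp [opsBy]
    · intro p' hp'
      by_cases hpp : p' = p
      · subst hpp
        exact hnone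
      · rw [(hframe hpp).2]
        exact h6 p' (Finset.mem_of_mem_insert_of_ne hp' hpp)
    · intro p' hp'
      rw [Finset.mem_insert, not_or] at hp'
      rw [(hframe hp'.1).1, (hframe hp'.1).2]
      exact h7 p' hp'.2

/-- One round: all processes that are about to respond do so, and all others with a pending operation
take a step. -/
theorem Snapshot.Good.round {S : A.Snapshot} (h : S.Good) {q M : ℕ} (hq : 1 ≤ q)
    (hA : A.UsesPrimitives q) (hK : ∀ p, (S.aware p).card ≤ M) (hF : ∀ o, (S.fam o).card ≤ M) :
    ∃ S' : A.Snapshot, S'.Good ∧ S.hist <+: S'.hist ∧ (∀ p, opsBy S'.hist p = opsBy S.hist p) ∧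
      (∀ p, (S'.aware p).card ≤ (q + 1) ^ 2 * M) ∧ (∀ o, (S'.fam o).card ≤ (q + 1) ^ 2 * M) ∧
      (∀ p, S.cfg.pending p = none → S'.cfg.pending p = none) ∧
      (∀ p, S.cfg.pending p ≠ none →
        ((∃ x s, A.next p (S.cfg.loc p) = .respond x s) ∧ S'.cfg.pending p = none) ∨
        (S'.cfg.pending p = S.cfg.pending p ∧ stepsBy S.hist p + 1 ≤ stepsBy S'.hist p)) := by
  classical
  obtain ⟨S₁, g₁, hist₁, ops₁, aware₁, fam₁, none₁, same₁⟩ := h.respond_all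
    {p | S.cfg.pending p ≠ none ∧ ∃ x s, A.next p (S.cfg.loc p) = .respond x s} (by simp)
  simp only [Finset.mem_filter, Finset.mem_univ, true_and] at none₁ same₁
  have hnext₁ : ∀ p, S₁.cfg.pending p ≠ none →
      ∃ P w objs cont, A.next p (S₁.cfg.loc p) = .apply P w objs cont := by
    intro p hp
    by_cases hr : S.cfg.pending p ≠ none ∧ ∃ x s, A.next p (S.cfg.loc p) = .respond x s
    · exact absurd (none₁ p hr) hp
    · obtain ⟨h1, h2⟩ := same₁ p hr
      rw [h2] at hp
      rw [h1]
      cases hn : A.next p (S.cfg.loc p) with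
      | respond x s => exact absurd ⟨hp, x, s, hn⟩ hr
      | apply P w objs cont => exact ⟨P, w, objs, cont, rfl⟩
  obtain ⟨S₂, t₂, mem₂, fam₂, aware₂⟩ := g₁.turn_invisible (q := q) (M := M)
    (by rwa [aware₁]) (by rwa [fam₁])
    {p | S₁.cfg.pending p ≠ none ∧ ∃ P w objs cont,
      A.next p (S₁.cfg.loc p) = .apply P w objs cont ∧ P.arity ≤ q ∧
        P.update (fun i => S₁.cfg.mem (objs i)) w = fun i => S₁.cfg.mem (objs i)} (by simp)
  set Q₂ : Finset (Fin n) := {p | S₁.cfg.pending p ≠ none ∧ ∃ P w objs cont,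
      A.next p (S₁.cfg.loc p) = .apply P w objs cont ∧ P.arity ≤ q ∧
        P.update (fun i => S₁.cfg.mem (objs i)) w = fun i => S₁.cfg.mem (objs i)} with hQ₂
  -- The invisible steps left memory as it was, so whether a remaining primitive would change it is
  -- the same question in `S₁` and in `S₂`.
  set Q₃ : Finset (Fin n) := {p | p ∉ Q₂ ∧ S₂.cfg.pending p ≠ none ∧ ∃ P w objs cont,
      A.next p (S₂.cfg.loc p) = .apply P w objs cont ∧ P.arity ≤ q ∧ P.IsConditional ∧
        P.update (fun i => S₂.cfg.mem (objs i)) w ≠ fun i => S₂.cfg.mem (objs i)} with hQ₃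
  obtain ⟨S₃, t₃, -, fam₃, aware₃⟩ := t₂.good.turn_conditional (q := q) (M := M)
    (by rwa [fam₂, fam₁]) Q₃
    (by
      intro p hp
      rw [t₂.aware p (Finset.mem_filter.1 hp).2.1, aware₁]
      exact hK p)
    (fun p hp => (Finset.mem_filter.1 hp).2.2)
  -- Whoever is left must be about to write: a read or a conditional primitive would have put the
  -- process into `Q₂` or `Q₃`.
  set Q₄ : Finset (Fin n) := {p | p ∉ Q₂ ∧ p ∉ Q₃ ∧ S₃.cfg.pending p ≠ none} with hQ₄
  have hle : (q + 1) * M ≤ (q + 1) ^ 2 * M :=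
    Nat.mul_le_mul_right _ (by nlinarith [Nat.zero_le q])
  obtain ⟨S₄, t₄, aware₄, fam₄⟩ := t₃.good.turn_write (M := (q + 1) ^ 2 * M)
    (fun o => (fam₃ o).trans hle)
    (by
      intro p
      by_cases hp : p ∈ Q₃
      · exact aware₃ p hp
      · rw [t₃.aware p hp]
        exact (aware₂ p).trans hle) Q₄
    (by
      intro p hp
      obtain ⟨h2, h3, hpend⟩ := (Finset.mem_filter.1 hp).2
      refine ⟨hpend, ?_⟩
      rw [t₃.pending] at hpend
      have hpend₁ := hpend
      rw [t₂.pending] at hpend₁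
      obtain ⟨P, w, objs, cont, hn⟩ := hnext₁ p hpend₁
      have hn₂ := hn
      rw [← t₂.loc p h2] at hn₂
      have hn₃ := hn₂
      rw [← t₃.loc p h3] at hn₃
      refine ⟨P, w, objs, cont, hn₃, ?_⟩
      have hcond (hc : P.IsConditional) (ha : P.arity ≤ q) : False := by
        by_cases hu : P.update (fun i => S₁.cfg.mem (objs i)) w = fun i => S₁.cfg.mem (objs i)
        · exact h2 (Finset.mem_filter.2 ⟨Finset.mem_univ _, hpend₁, P, w, objs, cont, hn, ha, hu⟩)
        · exact h3 (Finset.mem_filter.2 ⟨Finset.mem_univ _, h2, hpend, P, w, objs, cont, hn₂, ha, hc,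
            by rwa [mem₂]⟩)
      rcases hA _ _ _ _ _ _ hn with hr | hw | ⟨hc, ha⟩
      · exact (hcond hr.isConditional (hr.1.trans_le hq)).elim
      · exact hw
      · exact (hcond hc ha).elim)
  have t := (t₂.trans t₃).trans t₄
  refine ⟨S₄, t.good, hist₁.trans t.hist, fun p => (t.opsBy_eq p).trans (ops₁ p), ?_, fam₄, ?_, ?_⟩
  · intro p
    rw [aware₄]
    by_cases hp : p ∈ Q₃
    · exact aware₃ p hp
    · rw [t₃.aware p hp]
      exact (aware₂ p).trans hle
  · intro p hp
    rw [t.pending, (same₁ p (by simp [hp])).2, hp]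
  · intro p hp
    by_cases hr : S.cfg.pending p ≠ none ∧ ∃ x s, A.next p (S.cfg.loc p) = .respond x s
    · exact .inl ⟨hr.2, by rw [t.pending, none₁ p hr]⟩
    · refine .inr ⟨by rw [t.pending, (same₁ p hr).2], ?_⟩
      refine (Nat.add_le_add_right (stepsBy_le_of_prefix hist₁ p) 1).trans (t.steps p ?_)
      rw [Finset.mem_union, Finset.mem_union]
      by_cases h2 : p ∈ Q₂
      · exact .inl (.inl h2)
      · by_cases h3 : p ∈ Q₃
        · exact .inl (.inr h3)
        · refine .inr (Finset.mem_filter.2 ⟨Finset.mem_univ _, h2, h3, ?_⟩)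
          rwa [t₃.pending, t₂.pending, (same₁ p hr).2]

end Implementation

/-! ### Completing executions -/

namespace Implementation

variable {A : Implementation.{u} n}

/-- Determinism: it identifies a prescribed step with the one produced when a snapshot is extended.
-/
theorem Step.unique {C C' C'' : A.Config} {e : Event n} (h : A.Step C e C') (h' : A.Step C e C'') :
    C' = C'' := by
  cases h with
  | invoke p op hp => cases h'; rfl
  | step p P w objs cont hp hnext =>
    cases h' with
    | step _ P' w' objs' cont' hp' hnext' =>
      rw [hnext] at hnext'
      cases hnext'
      rfl
  | respond p x s hp hnext =>
    cases h' with
    | respond _ _ s' hp' hnext' =>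
      rw [hnext] at hnext'
      cases hnext'
      rfl

theorem Run.pending_eq_none {C C' : A.Config} {F : List (Event n)} (h : A.Run C F C')
    (hF : ∀ p, opsBy F p = []) {p : Fin n} (hp : C.pending p = none) : C'.pending p = none := by
  induction h with
  | nil => exact hp
  | @cons C₁ C₂ C₃ e E hs hr ih =>
    have hF' : ∀ p, opsBy [e] p = [] ∧ opsBy E p = [] := by
      intro p'
      have := hF p'
      rwa [← List.singleton_append, opsBy_append, List.append_eq_nil_iff] at this
    refine ih (fun p => (hF' p).2) ?_
    cases hs with
    | invoke p' op => simpa [opsBy] using (hF' p').1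
    | step => exact hp
    | respond p' x s =>
      by_cases hpp : p = p'
      · subst hpp; simp
      · simp [hpp, hp]

/-- A process that is about to apply a primitive takes a step before its operation is completed. -/
theorem Run.one_le_stepsBy {C C' : A.Config} {F : List (Event n)} (h : A.Run C F C') {p : Fin n}
    (hp : C.pending p ≠ none) (hp' : C'.pending p = none)
    (hnext : ∀ x s, A.next p (C.loc p) ≠ .respond x s) : 1 ≤ stepsBy F p := by
  induction h with
  | nil => exact absurd hp' hp
  | @cons C₁ C₂ C₃ e E hs hr ih =>
    rw [← List.singleton_append, stepsBy_append]
    by_cases he : p = e.proc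
    · subst he
      cases hs with
      | invoke p' op h1 => exact absurd h1 hp
      | step => simp [stepsBy, Event.proc]
      | respond p' x s h1 h2 => exact absurd h2 (hnext x s)
    · rw [← (hs.frame he).2] at hp
      rw [← (hs.frame he).1] at hnext
      exact (ih hp hp' hnext).trans (Nat.le_add_left _ _)

/-- Let the processes run alone, one after another. Solo fragments contain no invocations, so
processes that have already finished stay idle. -/
theorem Run.quiesce (hA : A.SoloTerminating) {E : List (Event n)} {C : A.Config}
    (h : A.Run A.init E C) :
    ∃ F C', A.Run C F C' ∧ C'.Quiescent ∧ ∀ p, opsBy F p = [] := by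
  suffices ∀ Q : Finset (Fin n), ∃ F C', A.Run C F C' ∧ (∀ p ∈ Q, C'.pending p = none) ∧
      ∀ p, opsBy F p = [] by
    obtain ⟨F, C', h1, h2, h3⟩ := this Finset.univ
    exact ⟨F, C', h1, fun p => h2 p (Finset.mem_univ p), h3⟩
  intro Q
  induction Q using Finset.induction_on with
  | empty => exact ⟨[], C, .nil _, by simp, by simp [opsBy]⟩
  | insert p Q hp ih =>
    obtain ⟨F, C', h1, h2, h3⟩ := ih
    by_cases hpend : C'.pending p = none
    · exact ⟨F, C', h1, fun p' hp' => (Finset.mem_insert.1 hp').elim (fun h => h ▸ hpend) (h2 p'), h3⟩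
    · obtain ⟨G, C'', h4, h5, h6⟩ := hA _ _ (h.append h1) p hpend
      have h7 : ∀ p', opsBy G p' = [] := by
        intro p'
        refine List.filterMap_eq_nil_iff.2 fun e he => ?_
        rcases h5 e he with rfl | ⟨x, rfl⟩ <;> rfl
      refine ⟨F ++ G, C'', h1.append h4, fun p' hp' => ?_, fun p' => by rw [opsBy_append, h3, h7]; rfl⟩
      rcases Finset.mem_insert.1 hp' with rfl | hp'
      · exact h6
      · exact h4.pending_eq_none h7 (h2 p' hp')

/-- Along an arbitrary fragment the sets may grow without control. What survives is that a process
without steps in it learns nothing. -/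
theorem Snapshot.Good.extend_run {S : A.Snapshot} (h : S.Good) {F : List (Event n)} {C : A.Config}
    (hF : A.Run S.cfg F C) :
    ∃ S' : A.Snapshot, S'.Good ∧ S'.hist = S.hist ++ F ∧ S'.cfg = C ∧
      ∀ p, stepsBy F p = 0 → S'.aware p = S.aware p := by
  generalize hC : S.cfg = C₀ at hF
  induction hF generalizing S with
  | nil => exact ⟨S, h, by simp, hC, fun _ _ => rfl⟩
  | @cons C₁ C₂ C₃ e E hs hr ih =>
    subst hC
    suffices ∃ S' : A.Snapshot, S'.Good ∧ S'.hist = S.hist ++ [e] ∧ S'.cfg = C₂ ∧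
        ∀ p, stepsBy [e] p = 0 → S'.aware p = S.aware p by
      obtain ⟨S', h1, h2, h3, h4⟩ := this
      obtain ⟨S'', h5, h6, h7, h8⟩ := ih h1 h3
      refine ⟨S'', h5, by simp [h6, h2], h7, fun p hp => ?_⟩
      rw [← List.singleton_append, stepsBy_append, Nat.add_eq_zero_iff] at hp
      rw [h8 p hp.2, h4 p hp.1]
    have hs' := hs
    cases hs with
    | invoke p op hp =>
      obtain ⟨C, h1, h2, -⟩ := h.invoke op hp
      exact ⟨_, h1, rfl, h2.unique hs', fun _ _ => rfl⟩
    | step p P w objs cont hp hnext =>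
      obtain ⟨S', h1, h2, h3, -, -, h4, -⟩ := h.step hp hnext
      refine ⟨S', h1, h2, h3.unique hs', fun p' hp' => h4 p' ?_⟩
      rintro rfl
      simp [stepsBy] at hp'
    | respond p x s hp hnext =>
      obtain ⟨C, h1, h2, -⟩ := h.respond hp hnext
      exact ⟨_, h1, rfl, h2.unique hs', fun _ _ => rfl⟩

theorem Snapshot.Good.invoke_all {S : A.Snapshot} (h : S.Good) (op : CounterOp)
    (Q : Finset (Fin n)) (hQ : ∀ p ∈ Q, S.cfg.pending p = none) :
    ∃ S' : A.Snapshot, S'.Good ∧ S.hist <+: S'.hist ∧ S'.aware = S.aware ∧ S'.fam = S.fam ∧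
      (∀ p ∈ Q, S'.cfg.pending p = some op ∧ opsBy S'.hist p = opsBy S.hist p ++ [op]) ∧
      (∀ p ∉ Q, S'.cfg.pending p = S.cfg.pending p ∧ opsBy S'.hist p = opsBy S.hist p) := by
  induction Q using Finset.induction_on with
  | empty => exact ⟨S, h, List.prefix_refl _, rfl, rfl, by simp, by simp⟩
  | insert p Q hp ih =>
    obtain ⟨S', h1, h2, h3, h4, h5, h6⟩ := ih fun p' hp' => hQ p' (Finset.mem_insert_of_mem hp')
    obtain ⟨C, h7, h8, h9⟩ := h1.invoke op ((h6 p hp).1.trans (hQ p (Finset.mem_insert_self _ _)))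
    have hframe {p' : Fin n} (hp' : p' ≠ p) := h8.frame (p := p') (by simpa [Event.proc] using hp')
    have hops (p') : opsBy (S'.hist ++ [.invoke p op]) p' =
        opsBy S'.hist p' ++ if p = p' then [op] else [] := by
      by_cases hpp : p = p' <;> simp [opsBy, hpp]
    refine ⟨_, h7, h2.trans (List.prefix_append _ _), h3, h4, ?_, ?_⟩
    · intro p' hp'
      by_cases hpp : p' = p
      · subst hpp
        exact ⟨h9, by simp [hops, (h6 p' hp).2]⟩
      · rw [hops, (hframe hpp).2, if_neg (Ne.symm hpp), List.append_nil]
        exact h5 p' (Finset.mem_of_mem_insert_of_ne hp' hpp)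
    · intro p' hp'
      rw [Finset.mem_insert, not_or] at hp'
      rw [hops, (hframe hp'.1).2, if_neg (Ne.symm hp'.1), List.append_nil]
      exact h6 p' hp'.2

theorem numSteps_le_of_prefix {E F : List (Event n)} (h : E <+: F) : numSteps E ≤ numSteps F := by
  obtain ⟨G, rfl⟩ := h
  rw [numSteps_append]
  exact Nat.le_add_right _ _

/-- All pending operations can be completed, and all missing reads can be performed. -/
theorem Snapshot.Good.finish {S : A.Snapshot} (h : S.Good) (hA : A.SoloTerminating)
    (hops : ∀ p, opsBy S.hist p = [.increment] ∨ opsBy S.hist p = [.increment, .read]) :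
    ∃ E C, A.Run A.init E C ∧ C.Quiescent ∧ (∀ p, opsBy E p = [.increment, .read]) ∧
      S.hist <+: E := by
  classical
  obtain ⟨F, C, h1, h2, h3⟩ := h.run.quiesce hA
  obtain ⟨S', h4, h5, rfl, -⟩ := h.extend_run h1
  obtain ⟨S'', h6, h7, -, -, h8, h9⟩ := h4.invoke_all .read
    {p | opsBy S.hist p = [.increment]} (fun p _ => h2 p)
  simp only [Finset.mem_filter, Finset.mem_univ, true_and] at h8 h9
  obtain ⟨G, C', h10, h11, h12⟩ := h6.run.quiesce hA
  refine ⟨_, C', h6.run.append h10, h11, fun p => ?_,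
    ((List.prefix_append _ _).trans (h5 ▸ h7)).trans (List.prefix_append _ _)⟩
  rw [opsBy_append, h12, List.append_nil]
  by_cases hp : opsBy S.hist p = [.increment]
  · rw [(h8 p hp).2, h5, opsBy_append, h3, hp]
    rfl
  · rw [(h9 p hp).2, h5, opsBy_append, h3, (hops p).resolve_left hp]
    rfl

/-! ### Two phases of rounds: increments, then reads -/

/-- Many rounds while the increments are in progress. -/
theorem exists_snapshot_increments {q : ℕ} (hq : 1 ≤ q) (hA : A.UsesPrimitives q) (r : ℕ) :
    ∃ S : A.Snapshot, S.Good ∧ (∀ p, opsBy S.hist p = [.increment]) ∧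
      (∀ p, (S.aware p).card ≤ ((q + 1) ^ 2) ^ r) ∧ (∀ o, (S.fam o).card ≤ ((q + 1) ^ 2) ^ r) ∧
      ∀ p, S.cfg.pending p ≠ none → r ≤ stepsBy S.hist p := by
  induction r with
  | zero =>
    obtain ⟨S, h1, -, h2, h3, h4, -⟩ := (Snapshot.good_init (A := A)).invoke_all .increment
      Finset.univ (fun _ _ => rfl)
    refine ⟨S, h1, fun p => (h4 p (Finset.mem_univ p)).2, ?_, ?_, fun _ _ => Nat.zero_le _⟩
    · simp [h2]
    · simp [h3]
  | succ r ih =>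
    obtain ⟨S, h1, h2, h3, h4, h5⟩ := ih
    obtain ⟨S', h6, h7, h8, h9, h10, h11, h12⟩ := h1.round hq hA h3 h4
    refine ⟨S', h6, fun p => (h8 p).trans (h2 p), fun p => (h9 p).trans_eq (by ring),
      fun o => (h10 o).trans_eq (by ring), fun p hp => ?_⟩
    -- Rounds contain no invocations, so a process pending after the round was pending throughout
    -- all earlier ones and has moved in each.
    have hp₀ : S.cfg.pending p ≠ none := fun h => hp (h11 p h)
    rcases h12 p hp₀ with h | h
    · exact absurd h.2 hp
    · exact (Nat.add_le_add_right (h5 p hp₀) 1).trans h.2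

theorem not_sublist_of_opsBy {E : List (Event n)} {p : Fin n}
    (h : opsBy E p = [.increment] ∨ opsBy E p = [.increment, .read]) :
    ¬ [CounterOp.increment, .increment].Sublist (opsBy E p) := by
  rcases h with h | h <;> rw [h] <;> intro h <;> simp at h

/-- Many rounds while the reads of the processes in `T` are in progress. -/
theorem Snapshot.Good.exists_reads {S : A.Snapshot} (h : S.Good) {q M : ℕ} (hq : 1 ≤ q)
    (hA : A.UsesPrimitives q) {k : ℝ} (hk : 0 < k) (hcount : A.IsMultCounter k)
    (hops : ∀ p, opsBy S.hist p = [.increment] ∨ opsBy S.hist p = [.increment, .read])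
    (hK : ∀ p, (S.aware p).card ≤ M) (hF : ∀ o, (S.fam o).card ≤ M)
    {E₁ : List (Event n)} {C₁ : A.Config} (h₁ : A.Run A.init E₁ C₁) (hE : E₁ <+: S.hist)
    {T : Finset (Fin n)} (hT : ∀ p ∈ T, opsBy E₁ p = [.increment] ∧ C₁.pending p = none)
    (hread : ∀ p ∈ T, S.cfg.pending p = some .read) (r : ℕ)
    (hr : (((q + 1) ^ 2) ^ r * M : ℕ) * k ^ 2 < T.card) :
    ∃ S' : A.Snapshot, S'.Good ∧ (∀ p, opsBy S'.hist p = opsBy S.hist p) ∧ S.hist <+: S'.hist ∧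
      (∀ p, (S'.aware p).card ≤ ((q + 1) ^ 2) ^ r * M) ∧
      (∀ o, (S'.fam o).card ≤ ((q + 1) ^ 2) ^ r * M) ∧
      ∀ p ∈ T, S'.cfg.pending p = some .read ∧ r ≤ stepsBy S'.hist p := by
  induction r with
  | zero => exact ⟨S, h, fun _ => rfl, List.prefix_refl _, by simpa using hK, by simpa using hF,
      fun p hp => ⟨hread p hp, Nat.zero_le _⟩⟩
  | succ r ih =>
    have hr' : (((q + 1) ^ 2) ^ r * M : ℕ) * k ^ 2 < T.card := by
      refine lt_of_le_of_lt (mul_le_mul_of_nonneg_right ?_ (sq_nonneg k)) hr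
      exact_mod_cast Nat.mul_le_mul_right M (Nat.pow_le_pow_right (by positivity) r.le_succ)
    obtain ⟨S₁, g₁, ops₁, hist₁, aware₁, fam₁, read₁⟩ := ih hr'
    obtain ⟨S', h6, h7, h8, h9, h10, h11, h12⟩ := g₁.round hq hA aware₁ fam₁
    refine ⟨S', h6, fun p => (h8 p).trans (ops₁ p), hist₁.trans h7,
      fun p => (h9 p).trans_eq (by ring), fun o => (h10 o).trans_eq (by ring), fun p hp => ?_⟩
    obtain ⟨hp₁, hs₁⟩ := read₁ p hp
    rcases h12 p (by simp [hp₁]) with ⟨⟨x, s, hnext⟩, -⟩ | ⟨h13, h14⟩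
    -- A response now would require awareness of at least `T.card / k ^ 2` processes, more than the
    -- bound after `r` rounds permits.
    · exfalso
      have := g₁.card_le hk hcount (fun p => not_sublist_of_opsBy (by rw [ops₁]; exact hops p)) h₁
        (hE.trans hist₁) (fun p hp => ⟨by simp [(hT p hp).1], (hT p hp).2⟩)
        (by simp [(hT p hp).1]) hp₁ hnext
      refine absurd (this.trans (mul_le_mul_of_nonneg_right ?_ (sq_nonneg k))) hr'.not_ge
      exact_mod_cast aware₁ p
    · exact ⟨h13.trans hp₁, (Nat.add_le_add_right hs₁ 1).trans h14⟩

theorem card_mul_le_numSteps {E : List (Event n)} {Q : Finset (Fin n)} {r : ℕ}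
    (h : ∀ p ∈ Q, r ≤ stepsBy E p) : Q.card * r ≤ numSteps E := by
  rw [← sum_stepsBy, ← smul_eq_mul]
  exact (Finset.card_nsmul_le_sum _ _ _ h).trans
    (Finset.sum_le_sum_of_subset (Finset.subset_univ Q))

/-- An execution with many rounds. -/
theorem exists_execution_of_rounds {q : ℕ} (hq : 1 ≤ q) (hA : A.UsesPrimitives q)
    (hsolo : A.SoloTerminating) {k : ℝ} (hk : 0 < k) (hcount : A.IsMultCounter k) (r : ℕ)
    (hr : 2 * ((q + 1 : ℝ) ^ (4 * r) * k ^ 2) < n) :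
    ∃ E C, A.Run A.init E C ∧ C.Quiescent ∧ (∀ p, opsBy E p = [.increment, .read]) ∧
      n * r ≤ 2 * numSteps E := by
  classical
  obtain ⟨S, h1, h2, h3, h4, h5⟩ := exists_snapshot_increments hq hA r
  set T : Finset (Fin n) := {p | S.cfg.pending p = none} with hT
  have hTc : T.card + (Tᶜ).card = n := by simp
  -- Either half of the processes are still incrementing after `r` rounds, which is already costly,
  -- or half are idle and can start reads.
  by_cases hn : n ≤ 2 * (Tᶜ).card
  · obtain ⟨E, C, h6, h7, h8, h9⟩ := h1.finish hsolo fun p => .inl (h2 p)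
    refine ⟨E, C, h6, h7, h8, ?_⟩
    have := card_mul_le_numSteps (E := S.hist) (Q := Tᶜ) (r := r)
      fun p hp => h5 p (by simpa [hT] using hp)
    have := numSteps_le_of_prefix h9
    have := Nat.mul_le_mul_right r hn
    nlinarith
  · have hn' : n ≤ 2 * T.card := by omega
    obtain ⟨S₁, g₁, hist₁, aware₁, fam₁, h6, h7⟩ := h1.invoke_all .read T
      fun p hp => (Finset.mem_filter.1 hp).2
    have hops : ∀ p, opsBy S₁.hist p = [.increment] ∨ opsBy S₁.hist p = [.increment, .read] := by
      intro p
      by_cases hp : p ∈ T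
      · right; rw [(h6 p hp).2, h2]; rfl
      · left; rw [(h7 p hp).2, h2]
    obtain ⟨S₂, g₂, ops₂, hist₂, -, -, h8⟩ := g₁.exists_reads hq hA hk hcount hops
      (by rwa [aware₁]) (by rwa [fam₁]) h1.run hist₁
      (fun p hp => ⟨h2 p, (Finset.mem_filter.1 hp).2⟩) (fun p hp => (h6 p hp).1) r (by
        have h9 : (n : ℝ) ≤ 2 * T.card := by exact_mod_cast hn'
        -- Each of the two phases of `r` rounds contributes a factor `(q + 1) ^ (2 * r)`.
        have h10 : ((((q + 1) ^ 2) ^ r * ((q + 1) ^ 2) ^ r : ℕ) : ℝ) = (q + 1 : ℝ) ^ (4 * r) := by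
          push_cast
          rw [← pow_mul, ← pow_add]
          congr 1
          omega
        rw [h10]
        linarith)
    obtain ⟨E, C, h9, h10, h11, h12⟩ := g₂.finish hsolo fun p => by rw [ops₂]; exact hops p
    refine ⟨E, C, h9, h10, h11, ?_⟩
    have := card_mul_le_numSteps (E := S₂.hist) (Q := T) (r := r) fun p hp => (h8 p hp).2
    have := numSteps_le_of_prefix h12
    have := Nat.mul_le_mul_right r hn'
    nlinarith

/-- An execution in which every process takes a step. -/
theorem exists_execution_of_sq_lt (hsolo : A.SoloTerminating) {k : ℝ} (hk : 0 < k)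
    (hcount : A.IsMultCounter k) (hkn : k ^ 2 < n) :
    ∃ E C, A.Run A.init E C ∧ C.Quiescent ∧ (∀ p, opsBy E p = [.increment, .read]) ∧
      n ≤ numSteps E := by
  obtain ⟨S, h1, -, aware₁, -, h2, -⟩ := (Snapshot.good_init (A := A)).invoke_all .increment
    Finset.univ (fun _ _ => rfl)
  obtain ⟨F, C, h3, h4, h5⟩ := h1.run.quiesce hsolo
  obtain ⟨S₁, g₁, hist₁, rfl, aware₂⟩ := h1.extend_run h3
  obtain ⟨S₂, g₂, hist₂, aware₃, -, h6, -⟩ := g₁.invoke_all .read Finset.univ (fun p _ => h4 p)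
  obtain ⟨G, C', h7, h8, h9⟩ := g₂.run.quiesce hsolo
  have ops₁ (p) : opsBy S₁.hist p = [.increment] := by
    rw [hist₁, opsBy_append, h5, (h2 p (Finset.mem_univ p)).2]
    rfl
  have ops₂ (p) : opsBy S₂.hist p = [.increment, .read] := by
    rw [(h6 p (Finset.mem_univ p)).2, ops₁]
    rfl
  refine ⟨S₂.hist ++ G, C', g₂.run.append h7, h8, fun p => by rw [opsBy_append, h9, ops₂]; rfl, ?_⟩
  -- A process without any step is aware only of itself. Were it to answer its read after all `n`
  -- increments, `n ≤ k ^ 2` would follow; and if it is not ready to answer, it must take a step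
  -- before the read completes.
  have key : ∀ p ∈ (Finset.univ : Finset (Fin n)), 1 ≤ stepsBy (S₂.hist ++ G) p := by
    intro p _
    by_contra h0
    have h0 : stepsBy (S₂.hist ++ G) p = 0 := by omega
    have hF : stepsBy F p = 0 := by
      have h10 : S.hist ++ F <+: S₂.hist ++ G := hist₁ ▸ hist₂.trans (List.prefix_append _ _)
      have := stepsBy_le_of_prefix h10 p
      rw [stepsBy_append] at this
      omega
    have hpend := (h6 p (Finset.mem_univ p)).1
    by_cases hnext : ∃ x s, A.next p (S₂.cfg.loc p) = .respond x s
    · obtain ⟨x, s, hnext⟩ := hnext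
      have := g₂.card_le hk hcount (fun p => not_sublist_of_opsBy (.inr (ops₂ p))) g₁.run hist₂
        (T := Finset.univ) (fun p _ => ⟨by simp [ops₁], h4 p⟩) (by simp [ops₁]) hpend hnext
      rw [aware₃, aware₂ p hF, aware₁] at this
      simp at this
      linarith
    · push Not at hnext
      have := h7.one_le_stepsBy (by simp [hpend]) (h8 p) hnext
      rw [stepsBy_append] at h0
      omega
  simpa using card_mul_le_numSteps key

end Implementation

/-! ### Amortization and choice of the number of rounds -/

namespace Implementation

variable {A : Implementation.{u} n}

open Classical in
theorem numSteps_eq_card (E : List (Event n)) : numSteps E =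
    ((Finset.range E.length).filter fun j => ∃ p, E[j]? = some (.step p)).card := by
  induction E using List.reverseRecOn with
  | nil => simp [numSteps]
  | append_singleton E e ih =>
    have hfilter : ((Finset.range E.length).filter fun j => ∃ p, (E ++ [e])[j]? = some (.step p)) =
        (Finset.range E.length).filter fun j => ∃ p, E[j]? = some (.step p) := by
      refine Finset.filter_congr fun j hj => ?_
      rw [List.getElem?_append_left (Finset.mem_range.1 hj)]
    rw [numSteps_append, ih, List.length_append, List.length_singleton, Finset.range_add_one,
      Finset.filter_insert, hfilter]
    cases e <;> simp [numSteps]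

/-- Every step belongs to an operation instance. -/
theorem Run.numSteps_le {E : List (Event n)} {C : A.Config} (h : A.Run A.init E C) :
    numSteps E ≤ ∑ i ∈ ops E, opSteps E i := by
  classical
  rw [numSteps_eq_card]
  refine (Finset.card_le_card ?_).trans (Finset.card_biUnion_le (s := ops E) (t := fun i =>
    (Finset.range E.length).filter fun j => ∃ p op, IsInstance E i p op ∧ i < j ∧
      E[j]? = some (.step p) ∧ NoResponseBetween E p i j)) |>.trans (le_of_eq ?_)
  · intro j hj
    obtain ⟨hj, p, hp⟩ := Finset.mem_filter.1 hj
    obtain ⟨hlt, hget⟩ := List.getElem?_eq_some_iff.1 hp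
    have hE : E = E.take j ++ (.step p :: E.drop (j + 1)) := by
      conv_lhs => rw [← List.take_append_drop j E, List.drop_eq_getElem_cons hlt, hget]
    rw [hE] at h
    obtain ⟨D, h1, h2⟩ := h.split
    cases h2 with
    | cons hs _ =>
      -- Only a process with a pending operation can take a step, so the step is charged to the
      -- latest unanswered invocation of `p`.
      have hpend : D.pending p ≠ none := by
        cases hs with
        | step _ P w objs cont hp' => exact hp'
      obtain ⟨op, hop⟩ := Option.ne_none_iff_exists'.1 hpend
      obtain ⟨i, hi, hno⟩ := h1.exists_instance hop
      have hij : i < j := by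
        have := (List.getElem?_eq_some_iff.1 hi).1
        rw [List.length_take] at this
        omega
      have hi' : IsInstance E i p op := by
        rwa [IsInstance, List.getElem?_take_of_lt hij] at hi
      refine Finset.mem_biUnion.2 ⟨i, Finset.mem_filter.2 ⟨?_, p, op, hi'⟩,
        Finset.mem_filter.2 ⟨hj, p, op, hi', hij, hp, ?_⟩⟩
      · exact Finset.mem_range.2 (hij.trans hlt)
      · intro m h3 h4 x h5
        exact hno m h3 x (by rwa [List.getElem?_take_of_lt h4])
  · refine Finset.sum_congr rfl fun i _ => ?_
    rw [opSteps]

/-- An instance is determined by its process and its kind, as each process invokes each kind only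
once. -/
theorem card_ops_le {E : List (Event n)} (hE : ∀ p, opsBy E p = [.increment, .read]) :
    (ops E).card ≤ 2 * n := by
  classical
  have := Finset.card_le_card_of_forall_subsingleton (s := ops E)
    (t := (Finset.univ : Finset (Fin n × Bool)))
    (fun i b => IsInstance E i b.1 (if b.2 then .increment else .read))
    (fun i hi => by
      obtain ⟨-, p, op, h⟩ := Finset.mem_filter.1 hi
      cases op with
      | increment => exact ⟨(p, true), Finset.mem_univ _, h⟩
      | read => exact ⟨(p, false), Finset.mem_univ _, h⟩)
    (fun b _ i hi j hj => by
      obtain ⟨p, b⟩ := b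
      refine IsInstance.eq_of_not_sublist ?_ hi.2 hj.2
      rw [hE]
      intro h
      cases b
      · cases h with
        | cons _ h => simpa using h.length_le
      · simp at h)
  simpa [mul_comm] using this

/-- One execution bounds the supremum from below: all its steps are charged to at most `2 * n`
operations. -/
theorem le_amtSteps {E : List (Event n)} (h : A.IsExecution E)
    (hE : ∀ p, opsBy E p = [.increment, .read]) (hn : 0 < n) {x : ℝ} (hx : 0 ≤ x)
    (hsteps : x * (2 * n) ≤ numSteps E) : ENNReal.ofReal x ≤ A.amtSteps := by
  classical
  obtain ⟨C, hC⟩ := h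
  have hne : (ops E).Nonempty := by
    have : CounterOp.read ∈ opsBy E ⟨0, hn⟩ := by simp [hE]
    obtain ⟨i, hi⟩ := List.mem_iff_getElem?.1 (mem_opsBy.1 this)
    exact ⟨i, Finset.mem_filter.2 ⟨Finset.mem_range.2 (List.getElem?_eq_some_iff.1 hi).1, _, _, hi⟩⟩
  refine le_trans ?_ (le_iSup₂_of_le E ⟨C, hC⟩ (le_iSup_of_le hne le_rfl))
  rw [ENNReal.le_div_iff_mul_le (.inl (by simpa using hne.ne_empty)) (.inl (by simp)),
    ← ENNReal.ofReal_natCast, ← ENNReal.ofReal_natCast, ← ENNReal.ofReal_mul hx]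
  refine ENNReal.ofReal_le_ofReal ?_
  have h1 : ((ops E).card : ℝ) ≤ 2 * n := by exact_mod_cast card_ops_le hE
  have h2 : (numSteps E : ℝ) ≤ (∑ i ∈ ops E, opSteps E i : ℕ) := by exact_mod_cast hC.numSteps_le
  exact ((mul_le_mul_of_nonneg_left h1 hx).trans hsteps).trans h2

/-- For `L ≤ 10` one step per process suffices. For larger `L` the number of rounds exceeds `(L - 6)
/ 4`, which is at least `L / 10` exactly when `L ≥ 10`; as `n * r` is at most twice the number of
steps, the factor `20` results. -/
theorem exists_execution {q : ℕ} (hq : 1 ≤ q) (hA : A.UsesPrimitives q)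
    (hsolo : A.SoloTerminating) {k : ℝ} (hk : 0 < k) (hcount : A.IsMultCounter k)
    (hkn : 2 * k ^ 2 ≤ n) :
    ∃ E C, A.Run A.init E C ∧ C.Quiescent ∧ (∀ p, opsBy E p = [.increment, .read]) ∧
      n * Real.logb (q + 1) (n / k ^ 2) ≤ 20 * numSteps E := by
  have hk2 : 0 < k ^ 2 := by positivity
  have hn : (0 : ℝ) < n := by linarith
  have hq' : (1 : ℝ) ≤ q := by exact_mod_cast hq
  set L := Real.logb (q + 1) (n / k ^ 2) with hL
  rcases le_total L 10 with hL10 | hL10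
  · obtain ⟨E, C, h1, h2, h3, h4⟩ := exists_execution_of_sq_lt hsolo hk hcount (by linarith)
    refine ⟨E, C, h1, h2, h3, ?_⟩
    have h4 : (n : ℝ) ≤ numSteps E := by exact_mod_cast h4
    nlinarith
  · set r := ⌊(L - 2) / 4⌋₊ with hr
    have hr1 : (r : ℝ) ≤ (L - 2) / 4 := Nat.floor_le (by linarith)
    have hr2 : (L - 2) / 4 < r + 1 := Nat.lt_floor_add_one _
    -- The two extra factors `q + 1` give at least `4`, covering the factor `2` in the hypothesis on
    -- `r` and its strictness.
    have hpow : (q + 1 : ℝ) ^ (4 * r + 2) ≤ n / k ^ 2 := by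
      rw [← Real.rpow_natCast, ← Real.le_logb_iff_rpow_le (by linarith) (by positivity)]
      push_cast
      linarith
    obtain ⟨E, C, h1, h2, h3, h4⟩ := exists_execution_of_rounds hq hA hsolo hk hcount r (by
      rw [le_div_iff₀ hk2, pow_add] at hpow
      have h5 : (0 : ℝ) < (q + 1 : ℝ) ^ (4 * r) * k ^ 2 := by positivity
      have h6 : (4 : ℝ) ≤ (q + 1 : ℝ) ^ 2 := by nlinarith
      have h7 := mul_le_mul_of_nonneg_left h6 h5.le
      linarith)
    refine ⟨E, C, h1, h2, h3, ?_⟩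
    have h4 : (n * r : ℝ) ≤ 2 * numSteps E := by exact_mod_cast h4
    nlinarith

end Implementation

end SharedCounter

theorem mainTheorem2 :
    ∃ c : ℝ, 0 < c ∧
      ∀ (n q : ℕ) (k : ℝ) (A : SharedCounter.Implementation.{u} n),
        1 ≤ q → 0 < k → k ≤ Real.sqrt ((n : ℝ) / 2) →
        A.UsesPrimitives q → A.SoloTerminating → A.IsMultCounter k →
        (∃ (E : List (SharedCounter.Event n)) (C : A.Config),
          A.Run A.init E C ∧ C.Quiescent ∧
          (∀ p, SharedCounter.opsBy E p = [.increment, .read]) ∧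
          c * ((n : ℝ) * Real.logb ((q : ℝ) + 1) ((n : ℝ) / k ^ 2)) ≤
            (SharedCounter.numSteps E : ℝ)) ∧
        ENNReal.ofReal (c * Real.logb ((q : ℝ) + 1) ((n : ℝ) / k ^ 2)) ≤ A.amtSteps := by
  -- The total is at least `n * L / 20` with `L` the logarithm; dividing by `2 * n` operations gives
  -- `1 / 40`.
  refine ⟨1 / 40, by norm_num, fun n q k A hq hk hkn hA hsolo hcount => ?_⟩
  have hkn' : 2 * k ^ 2 ≤ n := by
    have := (Real.le_sqrt hk.le (by positivity)).1 hkn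
    linarith
  have hk2 : 0 < k ^ 2 := by positivity
  have hn : (0 : ℝ) < n := by linarith
  have hq' : (1 : ℝ) ≤ q := by exact_mod_cast hq
  have hL : 0 ≤ Real.logb ((q : ℝ) + 1) ((n : ℝ) / k ^ 2) :=
    Real.logb_nonneg (by linarith) (by rw [le_div_iff₀ hk2]; linarith)
  obtain ⟨E, C, h1, h2, h3, h4⟩ :=
    SharedCounter.Implementation.exists_execution hq hA hsolo hk hcount hkn'
  have hnL := mul_nonneg hn.le hL
  exact ⟨⟨E, C, h1, h2, h3, by linarith⟩,
    SharedCounter.Implementation.le_amtSteps ⟨C, h1⟩ h3 (by exact_mod_cast hn) (by positivity)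
      (by linarith)⟩
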